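/- Let $\mathfrak{tsv}$ be the complex Lie algebra with basis $\{L_m, Y_m, M_m \mid m\in\mathbb{Z}\}$ and brackets $$[L_m,L_n]=(m-n)L_{m+n},\quad [L_m,Y_n]=-(m+n)Y_{m+n},\quad [L_m,M_n]=-(3m+n)M_{m+n},$$ $$[Y_m,Y_n]=(m-n)M_{m+n},\quad [Y_m,M_n]=[M_m,M_n]=0 .$$ Let $B$ be a $\mathfrak{tsv}$-module which, by restriction, is a free module of rank 1 over the universal enveloping algebra $U(\mathbb{C}L_0\oplus\mathbb{C}M_0\oplus\mathbb{C}Y_0)$ of the abelian subalgebra $\mathbb{C}L_0\oplus\mathbb{C}M_0\oplus\mathbb{C}Y_0$. Then there exist $\lambda\in\mathbb{C}\setminus\{0\}$, $a,b\in\mathbb{C}$, an integer $q\ge 1$, polynomials $\tau_0,\dots,\tau_q\in t\mathbb{C}[t]$ and $\gamma_j\in t\mathbb{C}[t]$ ($j\in\mathbb{Z}$) with $\gamma_0=0$, such that the following formulas define a $\mathfrak{tsv}$-module structure $\Phi(\lambda,a,b,q,\{\tau_i\},\{\gamma_j\})$ on $\mathbb{C}[s,t,v]$, and $B\cong\Phi(\lambda,a,b,q,\{\tau_i\},\{\gamma_j\})$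 as $\mathfrak{tsv}$-modules. For $m\in\mathbb{Z}$ and $f\in\mathbb{C}[s,t,v]$, with $W=\sum_{i=0}^q\tau_iv^i$ and $f_m=f(s+m,t,v)$, $$L_m. f=\lambda^m\Big\{\Big[s+\frac{m}{t}N_m+\frac{\gamma_m}{t}\Big]f_m-3mt\frac{\partial f_m}{\partial t}-m\big(mW+v+am^2t+b\big)\frac{\partial f_m}{\partial v}-\frac{m^2}{2}t\frac{\partial^2 f_m}{\partial v^2}\Big\},$$ $$N_m=\sum_{i=0}^{q}\Big(-\tau_i+\frac{3}{i+1}\tau_i-\frac{3t}{i+1}\frac{\partial\tau_i}{\partial t}\Big)v^{i+1}-\frac{m}{2}t\sum_{i=0}^{q}i\tau_iv^{i-1}-\frac{m}{2}W^2+3amtv-(am^2t+b)W,$$ $$M_m. f=\lambda^m\,t\,f_m,\qquad Y_m. f=\lambda^m\Big[\big(mW+v+am^2t+(1-\delta_{m,0})b\big)f_m+mt\frac{\partial f_m}{\partial v}\Big].$$ -/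

import Mathlib

/-- Labels of the basis vectors `L_m`, `Y_m`, `M_m` (`m ∈ ℤ`). -/
inductive TSVIndex : Type
  | L (m : ℤ)
  | Y (m : ℤ)
  | M (m : ℤ)

/-- The underlying space of the Lie algebra `tsv`: the complex vector space with basis
`{L_m, Y_m, M_m | m ∈ ℤ}`. -/
def TSV : Type := TSVIndex →₀ ℂ

noncomputable section

namespace TSV

instance : AddCommGroup TSV := inferInstanceAs (AddCommGroup (TSVIndex →₀ ℂ))

instance : Module ℂ TSV := inferInstanceAs (Module ℂ (TSVIndex →₀ ℂ))

/-- The defining basis of `tsv`. -/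
def basis : Module.Basis TSVIndex ℂ TSV := ⟨LinearEquiv.refl ℂ (TSVIndex →₀ ℂ)⟩

def L (m : ℤ) : TSV := basis (.L m)

def Y (m : ℤ) : TSV := basis (.Y m)

def M (m : ℤ) : TSV := basis (.M m)

/-- The brackets of basis vectors. -/
def structureBracket : TSVIndex → TSVIndex → TSV
  | .L m, .L n => ((m : ℂ) - n) • L (m + n)
  | .L m, .Y n => (-((m : ℂ) + n)) • Y (m + n)
  | .Y n, .L m => ((m : ℂ) + n) • Y (m + n)
  | .L m, .M n => (-(3 * (m : ℂ) + n)) • M (m + n)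
  | .M n, .L m => (3 * (m : ℂ) + n) • M (m + n)
  | .Y m, .Y n => ((m : ℂ) - n) • M (m + n)
  | .Y _, .M _ => 0
  | .M _, .Y _ => 0
  | .M _, .M _ => 0

/-- The bilinear extension of `structureBracket`. -/
def bracketMap : TSV →ₗ[ℂ] TSV →ₗ[ℂ] TSV :=
  basis.constr ℂ fun i => basis.constr ℂ fun j => structureBracket i j

theorem bracketMap_basis (i j : TSVIndex) :
    bracketMap (basis i) (basis j) = structureBracket i j := by
  simp [bracketMap, Module.Basis.constr_basis]

theorem bracketMap_L (m n : ℤ) : bracketMap (L m) (L n) = ((m : ℂ) - n) • L (m + n) :=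
  bracketMap_basis _ _

theorem bracketMap_LY (m n : ℤ) : bracketMap (L m) (Y n) = (-((m : ℂ) + n)) • Y (m + n) :=
  bracketMap_basis _ _

theorem bracketMap_YL (n m : ℤ) : bracketMap (Y n) (L m) = ((m : ℂ) + n) • Y (m + n) :=
  bracketMap_basis _ _

theorem bracketMap_LM (m n : ℤ) : bracketMap (L m) (M n) = (-(3 * (m : ℂ) + n)) • M (m + n) :=
  bracketMap_basis _ _

theorem bracketMap_ML (n m : ℤ) : bracketMap (M n) (L m) = (3 * (m : ℂ) + n) • M (m + n) :=
  bracketMap_basis _ _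

theorem bracketMap_Y (m n : ℤ) : bracketMap (Y m) (Y n) = ((m : ℂ) - n) • M (m + n) :=
  bracketMap_basis _ _

theorem bracketMap_YM (m n : ℤ) : bracketMap (Y m) (M n) = 0 := bracketMap_basis _ _

theorem bracketMap_MY (m n : ℤ) : bracketMap (M m) (Y n) = 0 := bracketMap_basis _ _

theorem bracketMap_M (m n : ℤ) : bracketMap (M m) (M n) = 0 := bracketMap_basis _ _

theorem bracketMap_skew (x y : TSV) : bracketMap x y = -bracketMap y x := by
  have h : bracketMap = -bracketMap.flip := by
    refine basis.ext fun i => basis.ext fun j => ?_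
    rcases i with m | m | m <;> rcases j with n | n | n <;>
      simp [bracketMap_basis, structureBracket, add_comm m n, ← neg_smul]
  have := LinearMap.congr_fun (LinearMap.congr_fun h x) y
  simpa using this

theorem induction_basis {p : TSV → Prop} (h0 : ∀ i, p (basis i))
    (hadd : ∀ x y, p x → p y → p (x + y)) (hsmul : ∀ (c : ℂ) x, p x → p (c • x)) (x : TSV) :
    p x := by
  have hz : p 0 := by simpa using hsmul 0 _ (h0 (.L 0))
  refine Submodule.span_induction (p := fun y _ => p y) ?_ hz (fun x y _ _ => hadd x y)
    (fun c x _ => hsmul c x) (basis.mem_span x)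
  rintro _ ⟨i, rfl⟩
  exact h0 i

theorem bracketMap_leibniz (x y z : TSV) :
    bracketMap x (bracketMap y z) =
      bracketMap (bracketMap x y) z + bracketMap y (bracketMap x z) := by
  induction x using induction_basis with
  | hadd x x' hx hx' => simp only [map_add, LinearMap.add_apply, hx, hx']; abel
  | hsmul c x hx => simp only [map_smul, LinearMap.smul_apply, hx, smul_add]
  | h0 i =>
  induction y using induction_basis with
  | hadd y y' hy hy' => simp only [map_add, LinearMap.add_apply, hy, hy']; abel
  | hsmul c y hy => simp only [map_smul, LinearMap.smul_apply, hy, smul_add]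
  | h0 j =>
  induction z using induction_basis with
  | hadd z z' hz hz' => simp only [map_add, hz, hz']; abel
  | hsmul c z hz => simp only [map_smul, hz, smul_add]
  | h0 k =>
  rcases i with m | m | m <;> rcases j with n | n | n <;> rcases k with r | r | r <;>
    simp only [structureBracket, L, Y, M, bracketMap_basis, map_smul, map_zero,
      LinearMap.smul_apply, LinearMap.zero_apply, add_left_comm, add_comm] <;>
    push_cast <;> module

theorem bracketMap_self (x : TSV) : bracketMap x x = 0 := by
  have h : (2 : ℂ) • bracketMap x x = 0 := by
    rw [two_smul]
    exact eq_neg_iff_add_eq_zero.1 (bracketMap_skew x x)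
  exact (smul_eq_zero.1 h).resolve_left two_ne_zero

instance : LieRing TSV where
  bracket x y := bracketMap x y
  add_lie x y z := by simp
  lie_add x y z := by simp
  lie_self x := bracketMap_self x
  leibniz_lie x y z := bracketMap_leibniz x y z

instance : LieAlgebra ℂ TSV where
  toModule := inferInstance
  lie_smul c x y := (bracketMap x).map_smul c y

theorem lie_L_L (m n : ℤ) : ⁅L m, L n⁆ = ((m : ℂ) - n) • L (m + n) := bracketMap_L m n

theorem lie_L_Y (m n : ℤ) : ⁅L m, Y n⁆ = (-((m : ℂ) + n)) • Y (m + n) := bracketMap_LY m n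

theorem lie_L_M (m n : ℤ) : ⁅L m, M n⁆ = (-(3 * (m : ℂ) + n)) • M (m + n) := bracketMap_LM m n

theorem lie_Y_Y (m n : ℤ) : ⁅Y m, Y n⁆ = ((m : ℂ) - n) • M (m + n) := bracketMap_Y m n

theorem lie_Y_M (m n : ℤ) : ⁅Y m, M n⁆ = 0 := bracketMap_YM m n

theorem lie_M_M (m n : ℤ) : ⁅M m, M n⁆ = 0 := bracketMap_M m n

/-- The (abelian) Lie subalgebra `ℂ L_0 ⊕ ℂ M_0 ⊕ ℂ Y_0` of `tsv`. -/
def zeroPart : LieSubalgebra ℂ TSV where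
  toSubmodule := Submodule.span ℂ {L 0, M 0, Y 0}
  lie_mem' := by
    intro x y hx hy
    have key : ⁅x, y⁆ = 0 := by
      have hx' : x ∈ Submodule.span ℂ {L 0, M 0, Y 0} := hx
      have hy' : y ∈ Submodule.span ℂ {L 0, M 0, Y 0} := hy
      obtain ⟨a, b, c, rfl⟩ := Submodule.mem_span_triple.1 hx'
      obtain ⟨a', b', c', rfl⟩ := Submodule.mem_span_triple.1 hy'
      have h1 : ⁅M 0, L 0⁆ = 0 := by rw [← lie_skew, lie_L_M]; simp
      have h2 : ⁅Y 0, L 0⁆ = 0 := by rw [← lie_skew, lie_L_Y]; simp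
      have h3 : ⁅M 0, Y 0⁆ = 0 := by rw [← lie_skew, lie_Y_M]; simp
      simp [lie_L_M, lie_L_Y, lie_Y_M, h1, h2, h3]
    rw [key]
    exact Submodule.zero_mem _

/-- The universal enveloping algebra `U(ℂ L_0 ⊕ ℂ M_0 ⊕ ℂ Y_0)`. -/
abbrev UZero : Type := UniversalEnvelopingAlgebra ℂ zeroPart

/-- The `tsv`-module `B`, restricted to `ℂ L_0 ⊕ ℂ M_0 ⊕ ℂ Y_0` and regarded as a module over
`U(ℂ L_0 ⊕ ℂ M_0 ⊕ ℂ Y_0)`, is free of rank 1: it has a basis consisting of one element. -/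
def IsFreeOfRankOne (B : Type*) [AddCommGroup B] [Module ℂ B] [LieRingModule TSV B]
    [LieModule ℂ TSV B] : Prop :=
  letI : Module UZero B := Module.compHom B
    (UniversalEnvelopingAlgebra.lift ℂ (LieModule.toEnd ℂ zeroPart B)).toRingHom
  Nonempty (Module.Basis (Fin 1) UZero B)

/-! ### The modules `Φ(λ, a, b, q, {τ_i}, {γ_j})` -/

/-- The polynomial algebra `ℂ[s, t, v]`. -/
abbrev Poly : Type := MvPolynomial (Fin 3) ℂ

abbrev s : Poly := MvPolynomial.X 0

abbrev t : Poly := MvPolynomial.X 1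

abbrev v : Poly := MvPolynomial.X 2

/-- A constant polynomial. -/
abbrev const (c : ℂ) : Poly := MvPolynomial.C c

/-- A one-variable polynomial, regarded as a polynomial in `t`. -/
def inT (p : Polynomial ℂ) : Poly := Polynomial.aeval t p

/-- `f(s, t, v) ↦ f(s + m, t, v)`. -/
def shift (m : ℤ) (f : Poly) : Poly := MvPolynomial.aeval ![s + const (m : ℂ), t, v] f

/-- `∂f/∂t`. -/
def dt (f : Poly) : Poly := MvPolynomial.pderiv 1 f

/-- `∂f/∂v`. -/
def dv (f : Poly) : Poly := MvPolynomial.pderiv 2 f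

/-- Division by `t`; it is used only for polynomials that are divisible by `t`. -/
def divT (f : Poly) : Poly := f.divMonomial (Finsupp.single 1 1)

/-- `∑_{i=0}^q τ_i v^i`. -/
def tauSum (q : ℕ) (τ : Fin (q + 1) → Polynomial ℂ) : Poly :=
  ∑ i, inT (τ i) * v ^ (i : ℕ)

/-- The polynomial in the large round brackets, which is divided by `t` in the action of `L_m`.
The term `i τ_i v^{i-1}` is zero for `i = 0`. -/
def phiNumerator (a b : ℂ) (q : ℕ) (τ : Fin (q + 1) → Polynomial ℂ) (m : ℤ) : Poly :=
  (∑ i : Fin (q + 1),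
      (-inT (τ i) + const (3 / ((i : ℕ) + 1)) * inT (τ i)
        - const (3 / ((i : ℕ) + 1)) * t * inT (Polynomial.derivative (τ i))) * v ^ ((i : ℕ) + 1))
    - const ((m : ℂ) / 2) * t *
        ∑ i : Fin (q + 1), const ((i : ℕ) : ℂ) * inT (τ i) * v ^ ((i : ℕ) - 1)
    - const ((m : ℂ) / 2) * tauSum q τ ^ 2
    + const (3 * a * m) * t * v
    - (const (a * (m : ℂ) ^ 2) * t + const b) * tauSum q τ

/-- The operator by which `L_m` acts on `Φ(λ, a, b, q, {τ_i}, {γ_j})`. -/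
def phiL (lam a b : ℂ) (q : ℕ) (τ : Fin (q + 1) → Polynomial ℂ) (γ : ℤ → Polynomial ℂ)
    (m : ℤ) (f : Poly) : Poly :=
  const (lam ^ m) *
    ((s + const (m : ℂ) * divT (phiNumerator a b q τ m) + divT (inT (γ m))) * shift m f
      - const (3 * (m : ℂ)) * t * dt (shift m f)
      - const (m : ℂ) *
          (const (m : ℂ) * tauSum q τ + v + const (a * (m : ℂ) ^ 2) * t + const b) *
          dv (shift m f)
      - const ((m : ℂ) ^ 2 / 2) * t * dv (dv (shift m f)))

/-- The operator by which `M_m` acts on `Φ(λ, a, b, q, {τ_i}, {γ_j})`. -/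
def phiM (lam : ℂ) (m : ℤ) (f : Poly) : Poly :=
  const (lam ^ m) * (t * shift m f)

/-- The operator by which `Y_m` acts on `Φ(λ, a, b, q, {τ_i}, {γ_j})`. -/
def phiY (lam a b : ℂ) (q : ℕ) (τ : Fin (q + 1) → Polynomial ℂ) (m : ℤ) (f : Poly) : Poly :=
  const (lam ^ m) *
    ((const (m : ℂ) * tauSum q τ + v + const (a * (m : ℂ) ^ 2) * t
        + const (if m = 0 then 0 else b)) * shift m f
      + const (m : ℂ) * t * dv (shift m f))

/-- The given action of `tsv` on `ℂ[s, t, v]` is that of `Φ(λ, a, b, q, {τ_i}, {γ_j})`. Since the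
`L_m`, `M_m`, `Y_m` form a basis of `tsv`, this determines the action. -/
def IsPhi (lam a b : ℂ) (q : ℕ) (τ : Fin (q + 1) → Polynomial ℂ) (γ : ℤ → Polynomial ℂ)
    [LieRingModule TSV Poly] : Prop :=
  ∀ (m : ℤ) (f : Poly),
    ⁅L m, f⁆ = phiL lam a b q τ γ m f ∧
    ⁅M m, f⁆ = phiM lam m f ∧
    ⁅Y m, f⁆ = phiY lam a b q τ m f

end TSV

end

noncomputable section

namespace TSV

open MvPolynomial (pderiv)

/-! ### Derivations and shifts of `ℂ[s, t, v]` -/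

/-! Freeness of rank one identifies `B` with ℂ[s,t,v], where L_0, M_0, Y_0 act as multiplication by
s, t, v (`IsFreeOfRankOne.exists_equiv`). Commuting M_m, Y_m, L_m past these multiplications shows
that each is a shift in s followed by a differential operator of order 0, 1, 2 respectively. Its
coefficients involve only the images g_m, u_m, l_m of 1 (`lie_M_eq`, `lie_Y_eq`, `lie_L_eq`), so the
classification amounts to solving the bracket relations evaluated at 1 (`ActionRelations`).

Shift invariance removes s and v from g_m and s from u_m, and makes l_m affine in s with slope in
ℂ[t]. A comparison of degrees and leading coefficients then forces g_m = λ^m t and slope λ^m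
(`exists_exponential`, `exists_scalar`). Write u_m = λ^m y_m and l_m = λ^m (s + r_m). The [Y,Y]
relation makes y_m equal to v + m(y_1 - v) up to a polynomial in t. The [L,Y] relation turns that
error into a cocycle equation, solved coefficientwise by `cocycle_coeff`; this produces W, a and b
(`exists_y`). The same relation gives t ∂r_m/∂v in terms of W. Setting t = 0 there forces t to
divide W (`t_dvd_W`), and integrating in v yields m N_m / t plus a free polynomial in t, which is
γ_m / t.

The formulas define a module because the structure is transported from `B`; the brackets need not be
verified on them. -/

abbrev Ds : Derivation ℂ Poly Poly := pderiv 0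

abbrev Dt : Derivation ℂ Poly Poly := pderiv 1

abbrev Dv : Derivation ℂ Poly Poly := pderiv 2

/-- `shift` as an algebra homomorphism. -/
def shiftHom (m : ℤ) : Poly →ₐ[ℂ] Poly := MvPolynomial.aeval ![s + const (m : ℂ), t, v]

theorem shift_eq (m : ℤ) (f : Poly) : shift m f = shiftHom m f := rfl

@[simp] theorem shiftHom_s (m : ℤ) : shiftHom m s = s + const (m : ℂ) := by simp [shiftHom]

@[simp] theorem shiftHom_t (m : ℤ) : shiftHom m t = t := by simp [shiftHom]

@[simp] theorem shiftHom_v (m : ℤ) : shiftHom m v = v := by simp [shiftHom]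

@[simp] theorem shiftHom_const (m : ℤ) (c : ℂ) : shiftHom m (const c) = const c := by
  simp [shiftHom]

@[simp] theorem shiftHom_zero (f : Poly) : shiftHom 0 f = f := by
  have : shiftHom 0 = AlgHom.id ℂ Poly := by
    ext i : 1
    fin_cases i <;> simp [shiftHom]
  rw [this]; rfl

theorem shiftHom_shiftHom (m n : ℤ) (f : Poly) :
    shiftHom m (shiftHom n f) = shiftHom (m + n) f := by
  have : (shiftHom m).comp (shiftHom n) = shiftHom (m + n) := by
    ext i : 1
    fin_cases i <;> simp [shiftHom, add_assoc]
  exact DFunLike.congr_fun this f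

theorem shiftHom_ne_zero (m : ℤ) {f : Poly} (h : f ≠ 0) : shiftHom m f ≠ 0 := by
  intro h0
  apply h
  have := shiftHom_shiftHom (-m) m f
  simpa [h0] using this.symm

@[simp] theorem pderiv_const (i : Fin 3) (c : ℂ) : pderiv i (const c) = 0 := MvPolynomial.pderiv_C

@[simp] theorem Ds_s : Ds s = 1 := MvPolynomial.pderiv_X_self 0

@[simp] theorem Ds_t : Ds t = 0 := MvPolynomial.pderiv_X_of_ne (by decide)

@[simp] theorem Ds_v : Ds v = 0 := MvPolynomial.pderiv_X_of_ne (by decide)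

@[simp] theorem Dt_s : Dt s = 0 := MvPolynomial.pderiv_X_of_ne (by decide)

@[simp] theorem Dt_t : Dt t = 1 := MvPolynomial.pderiv_X_self 1

@[simp] theorem Dt_v : Dt v = 0 := MvPolynomial.pderiv_X_of_ne (by decide)

@[simp] theorem Dv_s : Dv s = 0 := MvPolynomial.pderiv_X_of_ne (by decide)

@[simp] theorem Dv_t : Dv t = 0 := MvPolynomial.pderiv_X_of_ne (by decide)

@[simp] theorem Dv_v : Dv v = 1 := MvPolynomial.pderiv_X_self 2

theorem pderiv_shiftHom (i : Fin 3) (m : ℤ) (f : Poly) :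
    pderiv i (shiftHom m f) = shiftHom m (pderiv i f) := by
  induction f using MvPolynomial.induction_on with
  | C c =>
    change pderiv i (shiftHom m (const c)) = shiftHom m (pderiv i (const c))
    simp
  | add f g hf hg => simp only [map_add, hf, hg]
  | mul_X f j hf =>
    simp only [map_mul, MvPolynomial.pderiv_mul, map_add, hf]
    congr 2
    fin_cases i <;> fin_cases j <;> simp [shiftHom, MvPolynomial.pderiv_X]

/-- The commutator of two derivations is a derivation, and this one kills the variables. -/
theorem pderiv_comm (i j : Fin 3) (f : Poly) :
    pderiv i (pderiv j f) = pderiv j (pderiv i f) := by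
  have h : ⁅(pderiv i : Derivation ℂ Poly Poly), (pderiv j : Derivation ℂ Poly Poly)⁆ = 0 := by
    apply MvPolynomial.derivation_ext
    intro k
    classical
    change _ = 0
    rw [Derivation.commutator_apply, MvPolynomial.pderiv_X, MvPolynomial.pderiv_X]
    by_cases h1 : k = i <;> by_cases h2 : k = j <;> simp [Pi.single_apply, h1, h2, apply_ite]
  have := DFunLike.congr_fun h f
  rw [Derivation.commutator_apply] at this
  simpa [sub_eq_zero] using this

/-- Polynomials in `v` over `ℂ[t]`, regarded as elements of `ℂ[s, t, v]`. -/
def ofTV : Polynomial (Polynomial ℂ) →+* Poly :=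
  Polynomial.eval₂RingHom (Polynomial.aeval (R := ℂ) t).toRingHom v

theorem ofTV_X : ofTV Polynomial.X = v := by simp [ofTV]

theorem ofTV_C (p : Polynomial ℂ) : ofTV (Polynomial.C p) = inT p := by simp [ofTV, inT]

theorem inT_X : inT Polynomial.X = t := by simp [inT]

theorem inT_C (c : ℂ) : inT (Polynomial.C c) = const c := by
  simp [inT, MvPolynomial.algebraMap_eq]

theorem inT_add (p q : Polynomial ℂ) : inT (p + q) = inT p + inT q := by simp [inT]

theorem inT_sub (p q : Polynomial ℂ) : inT (p - q) = inT p - inT q := by simp [inT]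

theorem inT_mul (p q : Polynomial ℂ) : inT (p * q) = inT p * inT q := by simp [inT]

theorem inT_zero : inT 0 = 0 := by simp [inT]

theorem inT_one : inT 1 = 1 := by simp [inT]

theorem shiftHom_ofTV (m : ℤ) (P : Polynomial (Polynomial ℂ)) :
    shiftHom m (ofTV P) = ofTV P := by
  have : (shiftHom m).toRingHom.comp ofTV = ofTV := by
    ext
    · simp [ofTV]
    · simp [ofTV]
    · simp [ofTV]
  exact DFunLike.congr_fun this P

theorem Dv_inT (p : Polynomial ℂ) : Dv (inT p) = 0 := by
  simp [inT]

theorem Ds_inT (p : Polynomial ℂ) : Ds (inT p) = 0 := by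
  simp [inT]

theorem Dt_inT (p : Polynomial ℂ) : Dt (inT p) = inT (Polynomial.derivative p) := by
  simp [inT]

theorem Dv_ofTV (P : Polynomial (Polynomial ℂ)) :
    Dv (ofTV P) = ofTV (Polynomial.derivative P) := by
  induction P using Polynomial.induction_on' with
  | add P Q hP hQ => simp only [map_add, hP, hQ]
  | monomial n p =>
    rw [← Polynomial.C_mul_X_pow_eq_monomial]
    simp only [map_mul, map_pow, ofTV_C, ofTV_X, MvPolynomial.pderiv_mul, Dv_inT,
      MvPolynomial.pderiv_pow, Polynomial.derivative_C_mul_X_pow, Dv_v]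
    simp [inT]
    ring

theorem ofTV_injective : Function.Injective ofTV := by
  -- The left inverse sends s to 0; only the values at t and v matter.
  have : Function.LeftInverse
      (MvPolynomial.aeval (R := ℂ)
        (![0, Polynomial.C Polynomial.X, Polynomial.X] : Fin 3 → Polynomial (Polynomial ℂ))) ofTV := by
    intro P
    have : ((MvPolynomial.aeval (R := ℂ)
        (![0, Polynomial.C Polynomial.X, Polynomial.X] :
          Fin 3 → Polynomial (Polynomial ℂ))).toRingHom).comp ofTV
          = RingHom.id (Polynomial (Polynomial ℂ)) := by
      ext <;> simp [ofTV]
    exact DFunLike.congr_fun this P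
  exact this.injective

theorem inT_injective : Function.Injective inT := by
  intro p q h
  rw [← ofTV_C, ← ofTV_C] at h
  exact Polynomial.C_injective (ofTV_injective h)

/-! ### Kernels of partial derivatives and shift invariance -/

theorem apply_eq_zero_of_pderiv_eq_zero {i : Fin 3} {f : Poly} (h : pderiv i f = 0)
    {d : Fin 3 →₀ ℕ} (hd : d ∈ f.support) : d i = 0 := by
  by_contra hne
  have h1 : d = (d - Finsupp.single i 1) + Finsupp.single i 1 := by
    rw [tsub_add_cancel_of_le]
    simpa using Nat.one_le_iff_ne_zero.2 hne
  have h2 := MvPolynomial.coeff_pderiv (i := i) f (d - Finsupp.single i 1)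
  rw [h, ← h1] at h2
  simp only [MvPolynomial.coeff_zero] at h2
  rcases mul_eq_zero.1 h2.symm with h3 | h3
  · exact MvPolynomial.mem_support_iff.1 hd h3
  · exact Nat.cast_add_one_ne_zero _ h3

theorem degreeOf_eq_zero_of_pderiv {i : Fin 3} {f : Poly} (h : pderiv i f = 0) :
    f.degreeOf i = 0 := by
  rw [← Nat.le_zero, MvPolynomial.degreeOf_le_iff]
  exact fun d hd => (apply_eq_zero_of_pderiv_eq_zero h hd).le

theorem pderiv_eq_zero_of_degreeOf {i : Fin 3} {f : Poly} (h : f.degreeOf i = 0) :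
    pderiv i f = 0 := by
  apply MvPolynomial.pderiv_eq_zero_of_notMem_vars
  classical
  rw [MvPolynomial.degreeOf_def, Multiset.count_eq_zero] at h
  rwa [MvPolynomial.vars_def, Multiset.mem_toFinset]

/-- Degrees in one variable add up in a domain, and in characteristic zero a vanishing partial
derivative means degree zero. A factor of a nonzero product free of a variable is thus free of it
too. -/
theorem pderiv_left_eq_zero_of_mul {i : Fin 3} {f g : Poly} (hf : f ≠ 0) (hg : g ≠ 0)
    (h : pderiv i (f * g) = 0) : pderiv i f = 0 := by
  have := degreeOf_eq_zero_of_pderiv h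
  rw [MvPolynomial.degreeOf_mul_eq hf hg] at this
  exact pderiv_eq_zero_of_degreeOf (by omega)

theorem exists_ofTV {f : Poly} (h : Ds f = 0) : ∃ P, f = ofTV P := by
  refine ⟨∑ d ∈ f.support, Polynomial.monomial (d 2) (Polynomial.monomial (d 1) (f.coeff d)), ?_⟩
  conv_lhs => rw [f.as_sum]
  rw [map_sum]
  refine Finset.sum_congr rfl fun d hd => ?_
  rw [← Polynomial.C_mul_X_pow_eq_monomial, ← Polynomial.C_mul_X_pow_eq_monomial,
    MvPolynomial.monomial_eq, Finsupp.prod_fintype _ _ (by simp), Fin.prod_univ_three,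
    apply_eq_zero_of_pderiv_eq_zero h hd]
  rw [map_mul, map_pow, ofTV_X, ofTV_C, inT_mul, inT_C]
  simp [inT, mul_assoc]

theorem exists_inT {f : Poly} (hs : Ds f = 0) (hv : Dv f = 0) : ∃ p, f = inT p := by
  obtain ⟨P, rfl⟩ := exists_ofTV hs
  rw [Dv_ofTV, ← map_zero ofTV] at hv
  rw [Polynomial.eq_C_of_derivative_eq_zero (ofTV_injective hv), ofTV_C]
  exact ⟨_, rfl⟩

theorem shiftHom_of_Ds_eq_zero (m : ℤ) {f : Poly} (h : Ds f = 0) : shiftHom m f = f := by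
  obtain ⟨P, rfl⟩ := exists_ofTV h
  exact shiftHom_ofTV m P

/-- Taylor's formula for f affine in s: f - s ∂f/∂s does not involve s, so shifts fix it. -/
theorem shiftHom_of_Ds_Ds_eq_zero (m : ℤ) {f : Poly} (h : Ds (Ds f) = 0) :
    shiftHom m f = f + const (m : ℂ) * Ds f := by
  have h1 : Ds (f - s * Ds f) = 0 := by
    simp only [map_sub, MvPolynomial.pderiv_mul, Ds_s, h]; ring
  have h2 := shiftHom_of_Ds_eq_zero m h1
  simp only [map_sub, map_mul, shiftHom_s, shiftHom_of_Ds_eq_zero m h] at h2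
  linear_combination h2

theorem exists_iterate_Ds (f : Poly) : ∃ N, Ds^[N] f = 0 := by
  induction f using MvPolynomial.induction_on' with
  | monomial d c =>
    have : ∀ (k : ℕ) (d : Fin 3 →₀ ℕ) (c : ℂ), d 0 = k →
        Ds^[k + 1] (MvPolynomial.monomial d c) = 0 := by
      intro k
      induction k with
      | zero => intro d c hd; simp [MvPolynomial.pderiv_monomial, hd]
      | succ k ih =>
        intro d c hd
        rw [Function.iterate_succ_apply, MvPolynomial.pderiv_monomial]
        exact ih _ _ (by simp [hd])
    exact ⟨_, this _ d c rfl⟩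
  | add f g hf hg =>
    obtain ⟨N, hN⟩ := hf
    obtain ⟨N', hN'⟩ := hg
    have h0 : ∀ k, Ds^[k] (0 : Poly) = 0 := fun k => iterate_map_zero Ds k
    refine ⟨N + N', ?_⟩
    rw [iterate_map_add, Function.iterate_add_apply _ N N' g, hN', add_comm N,
      Function.iterate_add_apply, hN, h0, h0, add_zero]

/-- If f is shift invariant, so is ∂f/∂s, which needs one derivative fewer to vanish. By induction f
is affine in s, and an affine polynomial with a nonzero period is constant in s. -/
theorem Ds_eq_zero_of_shiftHom {m : ℤ} (hm : m ≠ 0) {f : Poly} (h : shiftHom m f = f) :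
    Ds f = 0 := by
  obtain ⟨N, hN⟩ := exists_iterate_Ds f
  induction N generalizing f with
  | zero => rw [Function.iterate_zero_apply] at hN; simp [hN]
  | succ N ih =>
    have h1 : Ds (Ds f) = 0 := ih (by rw [← pderiv_shiftHom, h]) hN
    have h2 := shiftHom_of_Ds_Ds_eq_zero m h1
    rw [h] at h2
    have h3 : const (m : ℂ) * Ds f = 0 := by linear_combination -h2
    refine (mul_eq_zero.1 h3).resolve_left ?_
    simpa using hm

theorem const_neg (c : ℂ) : const (-c) = -const c := map_neg _ c

theorem const_zero : const 0 = 0 := map_zero _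

theorem const_one : const 1 = 1 := map_one _

theorem const_add (c d : ℂ) : const (c + d) = const c + const d := map_add _ c d

theorem const_sub (c d : ℂ) : const (c - d) = const c - const d := map_sub _ c d

theorem const_mul (c d : ℂ) : const (c * d) = const c * const d := map_mul _ c d

theorem const_pow (c : ℂ) (n : ℕ) : const (c ^ n) = const c ^ n := map_pow _ c n

theorem const_ofNat (n : ℕ) [n.AtLeastTwo] : const ofNat(n) = OfNat.ofNat n :=
  map_ofNat _ n

theorem const_natCast (n : ℕ) : const (n : ℂ) = n := map_natCast _ n

theorem const_half : const (1 / 2) * 2 = 1 := by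
  rw [← const_ofNat, ← const_mul]; norm_num

theorem const_ne_zero {c : ℂ} (h : c ≠ 0) : const c ≠ 0 := by simpa using h

theorem t_ne_zero : t ≠ 0 := MvPolynomial.X_ne_zero 1

/-! ### Functional equations over ℂ[t] -/

open Polynomial in
/-- A system of polynomials satisfying the functional equations of the `s`-linear parts of the
actions of `M_m` and `L_m` is of exponential type. -/
theorem exists_exponential {p a : ℤ → ℂ[X]} (hp0 : p 0 = X) (ha0 : a 0 = 1) (hp : ∀ m, p m ≠ 0)
    (h1 : ∀ m n : ℤ, C (n : ℂ) * a m * p n =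
      C (3 * (m : ℂ) + n) * p (m + n) - C (3 * (m : ℂ)) * p m * derivative (p n))
    (h2 : ∀ m n : ℤ, C ((m : ℂ) - n) * (a m * a n) - C (3 * (m : ℂ)) * p m * derivative (a n)
      + C (3 * (n : ℂ)) * p n * derivative (a m) = C ((m : ℂ) - n) * a (m + n)) :
    ∃ lam : ℂ, lam ≠ 0 ∧ (∀ m, p m = C (lam ^ m) * X) ∧ ∀ m, a m = C (lam ^ m) := by
  have three_ne : (3 : ℂ[X]) ≠ 0 := by norm_num
  have hneg : ∀ m : ℤ, m ≠ 0 → a m * p (-m) = 3 * p m * derivative (p (-m)) - 2 * X := by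
    intro m hm
    have hc : (C (m : ℂ)) ≠ 0 := by simpa using hm
    have := h1 m (-m)
    rw [add_neg_cancel, hp0] at this
    apply mul_left_cancel₀ hc
    simp only [C_add, C_mul, C_neg, Int.cast_neg, map_ofNat] at this ⊢
    linear_combination -this
  -- The choice n = -3m kills the coefficient of p (m + n).
  have h3 : ∀ m : ℤ, m ≠ 0 → a m * p (-3 * m) = p m * derivative (p (-3 * m)) := by
    intro m hm
    have hc : (C (m : ℂ)) ≠ 0 := by simpa using hm
    have := h1 m (-3 * m)
    apply mul_left_cancel₀ (mul_ne_zero three_ne hc)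
    push_cast at this
    simp only [C_add, C_mul, C_neg, map_ofNat] at this ⊢
    linear_combination -this
  have h4 : ∀ m : ℤ, m ≠ 0 →
      2 * (a m * a (-m)) - 3 * (p m * derivative (a (-m)) + p (-m) * derivative (a m)) = 2 := by
    intro m hm
    have hc : (C (m : ℂ)) ≠ 0 := by simpa using hm
    have := h2 m (-m)
    rw [add_neg_cancel, ha0] at this
    apply mul_left_cancel₀ hc
    simp only [C_sub, C_mul, C_neg, Int.cast_neg, map_ofNat] at this ⊢
    linear_combination this
  -- If a m = 0, then `h4` makes p m a unit, hence constant. Now `hneg` at -m gives p m · (a (-m))'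
  -- = -2, whereas `h4` gives -3 p m · (a (-m))' = 2.
  have ha : ∀ m : ℤ, m ≠ 0 → a m ≠ 0 := by
    intro m hm h0
    have e1 := h4 m hm
    have e2 := hneg (-m) (by simpa using hm)
    simp only [h0, neg_neg, derivative_zero, mul_zero, zero_mul, add_zero, zero_sub] at e1 e2
    have hu : IsUnit (p m) := by
      apply IsUnit.of_mul_eq_one (C (-3/2) * derivative (a (-m)))
      rw [← C_ofNat, ← C_ofNat] at e1
      have : C (1/2 : ℂ) * C 2 = 1 := by rw [← C_mul]; norm_num
      have h32 : C (-3/2 : ℂ) = - C (1/2) * C 3 := by rw [← C_neg, ← C_mul]; norm_num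
      rw [h32]
      linear_combination C (1/2 : ℂ) * e1 + this
    obtain ⟨c, -, hc⟩ := Polynomial.isUnit_iff.1 hu
    rw [← hc, derivative_C] at e2
    have e3 := congrArg derivative e2
    simp at e3
    rw [← hc] at e1
    have : (2 : ℂ[X]) * 2 = 0 := by linear_combination 3 * e3 + e1
    simp at this
  have hdeg3 : ∀ m : ℤ, m ≠ 0 → (p (-3 * m)).natDegree ≠ 0 := by
    intro m hm h0
    have := h3 m hm
    rw [natDegree_eq_zero] at h0
    obtain ⟨c, hc⟩ := h0
    rw [← hc, derivative_C, mul_zero, hc] at this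
    exact mul_ne_zero (ha m hm) (hp _) this
  -- In `h3` differentiation lowers the degree of p (-3m) by exactly one. The leading coefficients
  -- of the same identity give `hlca`.
  have hdega : ∀ m : ℤ, m ≠ 0 → (p m).natDegree = (a m).natDegree + 1 := by
    intro m hm
    have e := congrArg natDegree (h3 m hm)
    have hd := natDegree_derivative (p (-3 * m))
    have h0 : derivative (p (-3 * m)) ≠ 0 := fun h =>
      hdeg3 m hm (derivative_eq_zero.1 h)
    have := hdeg3 m hm
    rw [natDegree_mul (ha m hm) (hp _), natDegree_mul (hp _) h0] at e
    omega
  have hcp' : ∀ m : ℤ, m ≠ 0 → (derivative (p m)).coeff (a m).natDegree =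
      ((a m).natDegree + 1) * (p m).leadingCoeff := by
    intro m hm
    rw [coeff_derivative, ← hdega m hm, coeff_natDegree, mul_comm]
  have hdp' : ∀ m : ℤ, m ≠ 0 → (derivative (p m)).natDegree ≤ (a m).natDegree := by
    intro m hm
    have := natDegree_derivative_le (p m)
    have := hdega m hm
    omega
  have hneg3 : ∀ m : ℤ, m ≠ 0 → -3 * m ≠ 0 := fun m hm => by omega
  have hneg1 : ∀ m : ℤ, m ≠ 0 → -m ≠ 0 := fun m hm => by omega
  have hlca : ∀ m : ℤ, m ≠ 0 →
      (a m).leadingCoeff = ((a (-3 * m)).natDegree + 1) * (p m).leadingCoeff := by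
    intro m hm
    have h5 := hneg3 m hm
    have e := congrArg (fun q => coeff q ((a m).natDegree + 1 + (a (-3 * m)).natDegree)) (h3 m hm)
    beta_reduce at e
    rw [coeff_mul_add_eq_of_natDegree_le (hdega m hm).le (hdp' _ h5), add_assoc, add_comm 1,
      coeff_mul_add_eq_of_natDegree_le le_rfl (hdega _ h5).le, hcp' _ h5, ← hdega m hm, ← hdega _ h5,
      coeff_natDegree, coeff_natDegree, coeff_natDegree] at e
    apply mul_right_cancel₀ (leadingCoeff_ne_zero.2 (hp (-3 * m)))
    linear_combination e
  have hda : ∀ m : ℤ, m ≠ 0 → (a m).natDegree = 0 := by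
    intro m hm
    by_contra hpos
    have hm' := hneg1 m hm
    -- Top coefficients in `hneg`. The degree hypothesis keeps the term 2X below the top.
    have hsum : ∀ k : ℤ, k ≠ 0 → (a k).natDegree + (a (-k)).natDegree ≠ 0 →
        ((a (-3 * k)).natDegree : ℂ) + 1 = 3 * ((a (-k)).natDegree + 1) := by
      intro k hk hs
      have hk' := hneg1 k hk
      have e := congrArg (fun q => coeff q ((a k).natDegree + ((a (-k)).natDegree + 1)))
        (hneg k hk)
      beta_reduce at e
      rw [coeff_mul_add_eq_of_natDegree_le le_rfl (hdega _ hk').le, coeff_sub, mul_assoc,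
        coeff_ofNat_mul, coeff_ofNat_mul, coeff_X_of_ne_one (by omega),
        show (a k).natDegree + ((a (-k)).natDegree + 1)
          = (a k).natDegree + 1 + (a (-k)).natDegree by ring,
        coeff_mul_add_eq_of_natDegree_le (hdega _ hk).le (hdp' _ hk'), hcp' _ hk', ← hdega _ hk,
        ← hdega _ hk', coeff_natDegree, coeff_natDegree, coeff_natDegree, hlca k hk] at e
      apply mul_right_cancel₀ (mul_ne_zero (leadingCoeff_ne_zero.2 (hp k))
        (leadingCoeff_ne_zero.2 (hp (-k))))
      linear_combination e
    have e1 := hsum m hm (by omega)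
    have e2 := hsum (-m) hm' (by rw [neg_neg]; omega)
    rw [neg_neg] at e2
    -- Multiplying by X before comparing in `h4` gives X q' the degree bound of q, so constant q
    -- needs no separate treatment.
    have hXd : ∀ q : ℂ[X], (X * derivative q).natDegree ≤ q.natDegree ∧
        (X * derivative q).coeff q.natDegree = q.natDegree * q.leadingCoeff := by
      intro q
      rcases Nat.eq_zero_or_eq_succ_pred q.natDegree with h | h
      · rw [natDegree_eq_zero] at h
        obtain ⟨c, rfl⟩ := h
        simp
      · constructor
        · have := natDegree_derivative_le q
          have := natDegree_mul_le (p := X) (q := derivative q)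
          rw [natDegree_X] at this
          omega
        · rw [h, coeff_X_mul, coeff_derivative, ← Nat.succ_eq_add_one, ← h, coeff_natDegree]
          rw [mul_comm]
          congr 1
          exact_mod_cast h.symm
    have e3 := congrArg (fun q => coeff (X * q) ((a m).natDegree + (a (-m)).natDegree + 1))
      (h4 m hm)
    have hX : X * (2 * (a m * a (-m))
          - 3 * (p m * derivative (a (-m)) + p (-m) * derivative (a m)))
        = 2 * (X * (a m * a (-m))) -
          3 * (p m * (X * derivative (a (-m))) + p (-m) * (X * derivative (a m))) := by ring
    beta_reduce at e3
    rw [hX, coeff_sub, coeff_ofNat_mul, coeff_ofNat_mul, coeff_add, coeff_X_mul,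
      coeff_mul_add_eq_of_natDegree_le le_rfl le_rfl, mul_comm X (2 : ℂ[X]), coeff_ofNat_mul,
      coeff_X_of_ne_one (by omega),
      show (a m).natDegree + (a (-m)).natDegree + 1
          = (a m).natDegree + 1 + (a (-m)).natDegree by ring,
      coeff_mul_add_eq_of_natDegree_le (hdega _ hm).le (hXd _).1,
      show (a m).natDegree + 1 + (a (-m)).natDegree
          = (a (-m)).natDegree + 1 + (a m).natDegree by ring,
      coeff_mul_add_eq_of_natDegree_le (hdega _ hm').le (hXd _).1, (hXd _).2, (hXd _).2,
      ← hdega _ hm, ← hdega _ hm', coeff_natDegree, coeff_natDegree, coeff_natDegree,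
      coeff_natDegree, hlca _ hm, hlca _ hm', e1, e2] at e3
    -- With d, d' the degrees of a m, a (-m), the top coefficient is 18(d+1)(d'+1) - 9(d'(d+1) +
    -- d(d'+1)) = 9(d+d'+2) times the leading coefficients of p m and p (-m), hence nonzero.
    have e4 : (9 * (((a m).natDegree : ℂ) + (a (-m)).natDegree + 2)) *
        ((p m).leadingCoeff * (p (-m)).leadingCoeff) = 0 := by
      linear_combination e3
    have e5 := (mul_eq_zero.1 e4).resolve_right (mul_ne_zero (leadingCoeff_ne_zero.2 (hp _))
      (leadingCoeff_ne_zero.2 (hp _)))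
    have e6 : (9 : ℂ) * (((a m).natDegree : ℂ) + (a (-m)).natDegree + 2) =
      ((9 * ((a m).natDegree + (a (-m)).natDegree + 2) : ℕ) : ℂ) := by push_cast; ring
    rw [e6, Nat.cast_eq_zero] at e5
    omega
  have hform : ∀ m : ℤ, ∃ α β : ℂ, p m = C α * X + C β ∧ a m = C α ∧ (m = 0 → α = 1 ∧ β = 0) := by
    intro m
    rcases eq_or_ne m 0 with rfl | hm
    · exact ⟨1, 0, by simp [hp0], by simp [ha0], by simp⟩
    · obtain ⟨α, β, h⟩ := exists_eq_X_add_C_of_natDegree_le_one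
        (p := p m) (by rw [hdega m hm, hda m hm])
      refine ⟨α, β, h, ?_, fun h => absurd h hm⟩
      rw [eq_C_of_natDegree_eq_zero (hda m hm)]
      have h5 := hlca m hm
      rw [hda _ (hneg3 m hm), leadingCoeff, leadingCoeff, hdega m hm, hda m hm] at h5
      rw [h5, h]
      simp [coeff_C]
  choose α β hpα haα hαβ0 using hform
  have hinv : ∀ m : ℤ, α m * α (-m) = 1 := by
    intro m
    rcases eq_or_ne m 0 with rfl | hm
    · simp [hαβ0]
    · have e := congrArg (coeff · 0) (h4 m hm)
      simp only [haα, derivative_C, mul_zero, add_zero, sub_zero] at e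
      simp [mul_coeff_zero] at e
      linear_combination e
  have hβ' : ∀ m : ℤ, m ≠ 0 → α m * β (-m) = 3 * (β m * α (-m)) := by
    intro m hm
    have e := congrArg (coeff · 0) (hneg m hm)
    simp [haα, hpα, mul_coeff_zero, coeff_X] at e
    linear_combination e
  -- Applying `hβ'` at m and at -m gives β m = 9 β m up to the unit α (-m).
  have hβ : ∀ m : ℤ, β m = 0 := by
    intro m
    rcases eq_or_ne m 0 with rfl | hm
    · simp [hαβ0]
    · have e1 := hβ' m hm
      have e2 := hβ' (-m) (hneg1 m hm)
      rw [neg_neg] at e2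
      linear_combination (-1/8 * α m) * e2 - 3/8 * α m * e1 - β m * hinv m
  have hmul0 : ∀ m n : ℤ, (3 * (m : ℂ) + n) * α (m + n) = (3 * (m : ℂ) + n) * (α m * α n) := by
    intro m n
    have e := congrArg (coeff · 1) (h1 m n)
    simp only [haα, hpα, hβ, ← C_mul] at e
    simp only [C_0, add_zero, derivative_C_mul, derivative_X, mul_one, ← C_mul, coeff_sub,
      ← mul_assoc, coeff_C_mul_X] at e
    simp at e
    linear_combination -e
  -- When 3m + n = 0, exchange m and n; both factors vanish only at m = n = 0.
  have hmul : ∀ m n : ℤ, α (m + n) = α m * α n := by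
    intro m n
    by_cases h : 3 * m + n = 0
    · by_cases h' : 3 * n + m = 0
      · obtain rfl : m = 0 := by omega
        obtain rfl : n = 0 := by omega
        simp [hαβ0]
      · have := hmul0 n m
        rw [add_comm n m, mul_comm (α n)] at this
        exact mul_left_cancel₀ (by exact_mod_cast h') this
    · exact mul_left_cancel₀ (by exact_mod_cast h) (hmul0 m n)
  have h10 : α 1 ≠ 0 := left_ne_zero_of_mul_eq_one (hinv 1)
  have hpow : ∀ m : ℤ, α m = α 1 ^ m := by
    intro m
    induction m using Int.induction_on with
    | zero => simp [hαβ0]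
    | succ i ih => rw [hmul, ih, zpow_add_one₀ h10]
    | pred i ih =>
      have := hmul (-i - 1) 1
      rw [sub_add_cancel, ih] at this
      rw [zpow_sub_one₀ h10, this, mul_assoc, mul_inv_cancel₀ h10, mul_one]
  exact ⟨α 1, h10, fun m => by rw [hpα, hβ, hpow m]; simp, fun m => by rw [haα, hpow m]⟩

/-- Solutions `H` of the functional equation satisfied by the coefficients of `t ^ k`. -/
theorem cocycle_coeff {k : ℕ} {H κ : ℤ → ℂ} (H1 : H 1 = 0)
    (h : ∀ m n : ℤ, ((m : ℂ) + n) * H (m + n) - m * H m - n * H n - 3 * m * (k * H n) = n * κ m) :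
    ∀ n : ℤ, n ≠ 0 → H n = if k = 0 then (n - 1) * H 2 else
      if k = 1 then ((n : ℂ) ^ 2 - n) / 2 * H 2 else 0 := by
  have hc : κ 1 = 2 * H 2 := by
    have := h 1 1
    norm_num [H1] at this
    exact this.symm
  -- The first two terms are symmetric in (m, n), so comparing (m, 1) with (1, m) determines κ.
  have hκ : ∀ m, κ m = 3 * k * H m + m * (2 * H 2) := by
    intro m
    have e1 := h m 1
    have e2 := h 1 m
    rw [add_comm 1 m] at e2
    push_cast at e1 e2
    rw [hc] at e2
    linear_combination e2 - e1 - (3 * k * m) * H1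
  have hadd : ∀ m n : ℤ, ((m : ℂ) + n) * H (m + n) =
      (m + 3 * k * n) * H m + (n + 3 * k * m) * H n + m * n * (2 * H 2) := by
    intro m n
    linear_combination h m n + n * hκ m
  have hk3 : (1 - 3 * k : ℂ) ≠ 0 := by
    intro h0
    have : (3 * k : ℕ) = 1 := by
      have : ((3 * k : ℕ) : ℂ) = (1 : ℕ) := by push_cast; linear_combination -h0
      exact_mod_cast this
    omega
  have hrefl : ∀ m : ℤ, m ≠ 0 → (1 - 3 * k : ℂ) * (H m - H (-m)) = m * (2 * H 2) := by
    intro m hm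
    have hm' : (m : ℂ) ≠ 0 := by exact_mod_cast hm
    have e := hadd m (-m)
    push_cast at e
    apply mul_left_cancel₀ hm'
    rw [add_neg_cancel, zero_mul] at e
    linear_combination -e
  have hk2 : (k : ℂ) * (k - 1) * H 2 = 0 := by
    have e1 := hrefl 1 one_ne_zero
    have e2 := hadd 2 (-1)
    norm_num [H1] at e1 e2
    linear_combination (-1 + 3 * (k : ℂ) * 2) / 9 * e1 - (1 - 3 * (k : ℂ)) / 9 * e2
  have hsucc : ∀ m : ℤ, ((m : ℂ) + 1) * H (m + 1) = (m + 3 * k) * H m + m * (2 * H 2) := by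
    intro m
    have := hadd m 1
    rw [H1] at this
    push_cast at this
    linear_combination this
  have hpos : ∀ n : ℕ, H (n + 1) = if k = 0 then ((n + 1 : ℂ) - 1) * H 2 else
      if k = 1 then ((n + 1 : ℂ) ^ 2 - (n + 1)) / 2 * H 2 else 0 := by
    intro n
    induction n with
    | zero => simp [H1]
    | succ n ih =>
      have hn : ((n : ℂ) + 1 + 1) ≠ 0 := by exact_mod_cast (n + 1).succ_ne_zero
      have e := hsucc (n + 1)
      rw [ih] at e
      push_cast at e ⊢
      apply mul_left_cancel₀ hn
      rw [e]
      split_ifs with h0 h1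
      · subst h0; push_cast; ring
      · subst h1; push_cast; ring
      · have : H 2 = 0 := by
          refine (mul_eq_zero.1 hk2).resolve_left (mul_ne_zero (by exact_mod_cast h0) ?_)
          rw [sub_ne_zero]
          exact_mod_cast h1
        rw [this]; ring
  have hpos' : ∀ n : ℤ, 0 < n → H n = if k = 0 then (n - 1) * H 2 else
      if k = 1 then ((n : ℂ) ^ 2 - n) / 2 * H 2 else 0 := by
    intro n hn
    obtain ⟨j, rfl⟩ : ∃ j : ℕ, n = j + 1 := ⟨(n - 1).toNat, by omega⟩
    rw [hpos]
    push_cast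
    rfl
  intro n hn
  rcases lt_or_gt_of_ne hn with h0 | h0
  · have e := hrefl (-n) (by omega)
    rw [neg_neg, hpos' (-n) (by omega)] at e
    apply mul_left_cancel₀ hk3
    push_cast at e
    split_ifs at e ⊢ with h0 h1
    · subst h0; push_cast at *; linear_combination -e
    · subst h1; push_cast at *; linear_combination -e
    · have : H 2 = 0 := by
        refine (mul_eq_zero.1 hk2).resolve_left (mul_ne_zero (by exact_mod_cast h0) ?_)
        rw [sub_ne_zero]
        exact_mod_cast h1
      rw [this] at e
      linear_combination -e
  · exact hpos' n h0

open Polynomial in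
-- X d/dX multiplies the coefficient of X^k by k, so the equation splits into those of
-- `cocycle_coeff`. The factors m, n, m + n leave index 0 undetermined there, so `h0` supplies it.
theorem cocycle_polynomial {h K : ℤ → ℂ[X]} (h0 : h 0 = 0) (h1 : h 1 = 0)
    (hK : ∀ m n : ℤ, C ((m : ℂ) + n) * h (m + n) - C (m : ℂ) * h m - C (n : ℂ) * h n
      - C (3 * (m : ℂ)) * (X * derivative (h n)) = C (n : ℂ) * K m) :
    ∃ a b : ℂ, ∀ n : ℤ,
      h n = C (a * ((n : ℂ) ^ 2 - n)) * X + C (if n = 0 then 0 else b * (1 - n)) := by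
  refine ⟨(h 2).coeff 1 / 2, -(h 2).coeff 0, fun n => ?_⟩
  rcases eq_or_ne n 0 with rfl | hn
  · simp [h0]
  ext k
  rw [cocycle_coeff (k := k) (H := fun n => (h n).coeff k) (κ := fun n => (K n).coeff k) ?_ ?_ n hn]
  · rw [if_neg hn, coeff_add, coeff_C_mul, coeff_X, coeff_C]
    rcases k with _ | _ | k
    · simp; ring
    · simp; ring
    · simp
  · simp [h1]
  · intro m n
    have e := congrArg (coeff · k) (hK m n)
    simp only [coeff_sub, coeff_C_mul] at e
    rw [← e]
    congr 2
    rcases k with _ | k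
    · simp
    · rw [coeff_X_mul, coeff_derivative]; push_cast; ring

/-! ### Module structures on `ℂ[s, t, v]` extending the multiplication by `s, t, v` -/

theorem lie_M_Y (m n : ℤ) : ⁅M m, Y n⁆ = 0 := bracketMap_MY m n

theorem lie_M_L (n m : ℤ) : ⁅M n, L m⁆ = (3 * (m : ℂ) + n) • M (m + n) := bracketMap_ML n m

theorem lie_Y_L (n m : ℤ) : ⁅Y n, L m⁆ = ((m : ℂ) + n) • Y (m + n) := bracketMap_YL n m

theorem smul_eq (c : ℂ) (f : Poly) : c • f = const c * f := MvPolynomial.C_mul'.symm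

section Poly

variable [LieRingModule TSV Poly] [LieModule ℂ TSV Poly]

theorem lie_const_mul (x : TSV) (c : ℂ) (f : Poly) : ⁅x, const c * f⁆ = const c * ⁅x, f⁆ := by
  rw [MvPolynomial.C_mul', lie_smul, MvPolynomial.C_mul']

/-- M_m commutes with multiplication by t and v, and [M_m, L_0] = m M_m turns multiplication by s
into s + m. Induction on monomials reduces everything to the image of 1. -/
theorem lie_M_eq (hL : ∀ f : Poly, ⁅L 0, f⁆ = s * f) (hM : ∀ f : Poly, ⁅M 0, f⁆ = t * f)
    (hY : ∀ f : Poly, ⁅Y 0, f⁆ = v * f) (m : ℤ) (f : Poly) :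
    ⁅M m, f⁆ = shiftHom m f * ⁅M m, (1 : Poly)⁆ := by
  induction f using MvPolynomial.induction_on with
  | C c =>
    have := lie_const_mul (M m) c 1
    rw [mul_one] at this
    change ⁅M m, const c⁆ = shiftHom m (const c) * _
    rw [this, shiftHom_const]
  | add f g hf hg => rw [lie_add, hf, hg, map_add, add_mul]
  | mul_X f i hf =>
    rw [mul_comm f, map_mul, mul_assoc, ← hf]
    fin_cases i
    · change ⁅M m, s * f⁆ = shiftHom m s * _
      rw [← hL, leibniz_lie, lie_M_L, smul_lie, hL, smul_eq, shiftHom_s]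
      simp; ring
    · change ⁅M m, t * f⁆ = shiftHom m t * _
      rw [← hM, leibniz_lie, lie_M_M, zero_lie, hM, shiftHom_t, zero_add]
    · change ⁅M m, v * f⁆ = shiftHom m v * _
      rw [← hY, leibniz_lie, lie_M_Y, zero_lie, hY, shiftHom_v, zero_add]

/-- As for M_m, except that [Y_m, Y_0] = m M_m makes each factor v contribute an M_m term, whence
the first derivative in v. -/
theorem lie_Y_eq (hL : ∀ f : Poly, ⁅L 0, f⁆ = s * f) (hM : ∀ f : Poly, ⁅M 0, f⁆ = t * f)
    (hY : ∀ f : Poly, ⁅Y 0, f⁆ = v * f) (m : ℤ) (f : Poly) :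
    ⁅Y m, f⁆ = shiftHom m f * ⁅Y m, (1 : Poly)⁆
      + const (m : ℂ) * Dv (shiftHom m f) * ⁅M m, (1 : Poly)⁆ := by
  induction f using MvPolynomial.induction_on with
  | C c =>
    have := lie_const_mul (Y m) c 1
    rw [mul_one] at this
    change ⁅Y m, const c⁆ = shiftHom m (const c) * _ + _ * Dv (shiftHom m (const c)) * _
    rw [this, shiftHom_const, pderiv_const]
    ring
  | add f g hf hg => rw [lie_add, hf, hg, map_add, map_add]; ring
  | mul_X f i hf =>
    rw [mul_comm f, map_mul, MvPolynomial.pderiv_mul]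
    fin_cases i
    · change ⁅Y m, s * f⁆ = shiftHom m s * _ * _ + _ * (Dv (shiftHom m s) * _ + shiftHom m s * _) * _
      rw [← hL, leibniz_lie, lie_Y_L, smul_lie, hL, smul_eq, shiftHom_s, zero_add, hf, map_add,
        Dv_s, pderiv_const]
      simp; ring
    · change ⁅Y m, t * f⁆ = shiftHom m t * _ * _ + _ * (Dv (shiftHom m t) * _ + shiftHom m t * _) * _
      rw [← hM, leibniz_lie, lie_Y_M, zero_lie, hM, shiftHom_t, zero_add, hf, Dv_t]
      ring
    · change ⁅Y m, v * f⁆ = shiftHom m v * _ * _ + _ * (Dv (shiftHom m v) * _ + shiftHom m v * _) * _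
      rw [← hY, leibniz_lie, lie_Y_Y, smul_lie, hY, shiftHom_v, hf, Dv_v, smul_eq, add_zero,
        lie_M_eq hL hM hY m f]
      simp; ring

/-- Passing t produces M_m and passing v produces Y_m, which in turn produces M_m when it passes
further factors v; this is the second derivative in v. -/
theorem lie_L_eq (hL : ∀ f : Poly, ⁅L 0, f⁆ = s * f) (hM : ∀ f : Poly, ⁅M 0, f⁆ = t * f)
    (hY : ∀ f : Poly, ⁅Y 0, f⁆ = v * f) (m : ℤ) (f : Poly) :
    ⁅L m, f⁆ = shiftHom m f * ⁅L m, (1 : Poly)⁆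
      - const (3 * (m : ℂ)) * Dt (shiftHom m f) * ⁅M m, (1 : Poly)⁆
      - const (m : ℂ) * Dv (shiftHom m f) * ⁅Y m, (1 : Poly)⁆
      - const ((m : ℂ) ^ 2 / 2) * Dv (Dv (shiftHom m f)) * ⁅M m, (1 : Poly)⁆ := by
  induction f using MvPolynomial.induction_on with
  | C c =>
    have := lie_const_mul (L m) c 1
    rw [mul_one] at this
    change ⁅L m, const c⁆ = shiftHom m (const c) * _ - _ * Dt (shiftHom m (const c)) * _
      - _ * Dv (shiftHom m (const c)) * _ - _ * Dv (Dv (shiftHom m (const c))) * _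
    rw [this, shiftHom_const, pderiv_const, pderiv_const, map_zero]
    ring
  | add f g hf hg => rw [lie_add, hf, hg]; simp only [map_add]; ring
  | mul_X f i hf =>
    rw [mul_comm f]
    fin_cases i
    · change ⁅L m, s * f⁆ = shiftHom m (s * _) * _ - _ * Dt (shiftHom m (s * _)) * _
        - _ * Dv (shiftHom m (s * _)) * _ - _ * Dv (Dv (shiftHom m (s * _))) * _
      rw [← hL, leibniz_lie, lie_L_L, smul_lie, hL, hL, hf]
      simp only [map_mul, map_add, MvPolynomial.pderiv_mul, shiftHom_s, Dv_s, Dt_s, pderiv_const,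
        smul_eq, Int.cast_zero, sub_zero, add_zero, zero_add, zero_mul]
      rw [hf]
      simp only [map_mul]
      ring
    · change ⁅L m, t * f⁆ = shiftHom m (t * _) * _ - _ * Dt (shiftHom m (t * _)) * _
        - _ * Dv (shiftHom m (t * _)) * _ - _ * Dv (Dv (shiftHom m (t * _))) * _
      rw [← hM, leibniz_lie, lie_L_M, smul_lie, hM, hM, hf]
      simp only [map_mul, MvPolynomial.pderiv_mul, shiftHom_t, Dv_t, Dt_t,
        smul_eq, Int.cast_zero, add_zero, zero_add, zero_mul, lie_M_eq hL hM hY m f,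
        map_neg]
      ring
    · change ⁅L m, v * f⁆ = shiftHom m (v * _) * _ - _ * Dt (shiftHom m (v * _)) * _
        - _ * Dv (shiftHom m (v * _)) * _ - _ * Dv (Dv (shiftHom m (v * _))) * _
      rw [← hY, leibniz_lie, lie_L_Y, smul_lie, hY, hY, hf]
      have hc : const ((m : ℂ) ^ 2 / 2) = const (m : ℂ) ^ 2 * const (1 / 2) := by
        rw [← map_pow, ← map_mul]; congr 1; ring
      simp only [map_mul, map_add, MvPolynomial.pderiv_mul, shiftHom_v, Dv_v, Dt_v,
        smul_eq, Int.cast_zero, add_zero, zero_add, zero_mul, lie_Y_eq hL hM hY m f,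
        map_neg, one_mul, hc]
      linear_combination (const (m : ℂ) ^ 2 * Dv (shiftHom m f) * ⁅M m, (1 : Poly)⁆) * const_half

end Poly

/-! ### Bracket relations evaluated at 1 -/

/-- The relations satisfied by the images `g m`, `u m`, `l m` of `1` under `M_m`, `Y_m`, `L_m`. -/
structure ActionRelations (g u l : ℤ → Poly) : Prop where
  g_zero : g 0 = t
  u_zero : u 0 = v
  l_zero : l 0 = s
  MM (m n : ℤ) : shiftHom m (g n) * g m = shiftHom n (g m) * g n
  YM (m n : ℤ) : shiftHom m (g n) * u m + const (m : ℂ) * Dv (shiftHom m (g n)) * g m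
    = shiftHom n (u m) * g n
  YY (m n : ℤ) : (shiftHom m (u n) * u m + const (m : ℂ) * Dv (shiftHom m (u n)) * g m)
      - (shiftHom n (u m) * u n + const (n : ℂ) * Dv (shiftHom n (u m)) * g n)
    = const ((m : ℂ) - n) * g (m + n)
  LM (m n : ℤ) : (shiftHom m (g n) * l m - const (3 * (m : ℂ)) * Dt (shiftHom m (g n)) * g m
      - const (m : ℂ) * Dv (shiftHom m (g n)) * u m
      - const ((m : ℂ) ^ 2 / 2) * Dv (Dv (shiftHom m (g n))) * g m)
      - shiftHom n (l m) * g n = const (-(3 * (m : ℂ) + n)) * g (m + n)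
  LY (m n : ℤ) : (shiftHom m (u n) * l m - const (3 * (m : ℂ)) * Dt (shiftHom m (u n)) * g m
      - const (m : ℂ) * Dv (shiftHom m (u n)) * u m
      - const ((m : ℂ) ^ 2 / 2) * Dv (Dv (shiftHom m (u n))) * g m)
      - (shiftHom n (l m) * u n + const (n : ℂ) * Dv (shiftHom n (l m)) * g n)
    = const (-((m : ℂ) + n)) * u (m + n)
  LL (m n : ℤ) : (shiftHom m (l n) * l m - const (3 * (m : ℂ)) * Dt (shiftHom m (l n)) * g m
      - const (m : ℂ) * Dv (shiftHom m (l n)) * u m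
      - const ((m : ℂ) ^ 2 / 2) * Dv (Dv (shiftHom m (l n))) * g m)
      - (shiftHom n (l m) * l n - const (3 * (n : ℂ)) * Dt (shiftHom n (l m)) * g n
      - const (n : ℂ) * Dv (shiftHom n (l m)) * u n
      - const ((n : ℂ) ^ 2 / 2) * Dv (Dv (shiftHom n (l m))) * g n)
    = const ((m : ℂ) - n) * l (m + n)

theorem actionRelations [LieRingModule TSV Poly] [LieModule ℂ TSV Poly]
    (hL : ∀ f : Poly, ⁅L 0, f⁆ = s * f) (hM : ∀ f : Poly, ⁅M 0, f⁆ = t * f)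
    (hY : ∀ f : Poly, ⁅Y 0, f⁆ = v * f) :
    ActionRelations (fun m => ⁅M m, (1 : Poly)⁆) (fun m => ⁅Y m, (1 : Poly)⁆)
      (fun m => ⁅L m, (1 : Poly)⁆) where
  g_zero := by simp [hM]
  u_zero := by simp [hY]
  l_zero := by simp [hL]
  MM m n := by
    have := lie_lie (M m) (M n) (1 : Poly)
    rw [lie_M_M, zero_lie] at this
    rw [← lie_M_eq hL hM hY, ← lie_M_eq hL hM hY]
    exact (sub_eq_zero.1 this.symm)
  YM m n := by
    have := lie_lie (Y m) (M n) (1 : Poly)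
    rw [lie_Y_M, zero_lie] at this
    rw [← lie_M_eq hL hM hY, ← lie_Y_eq hL hM hY]
    exact (sub_eq_zero.1 this.symm)
  YY m n := by
    have := lie_lie (Y m) (Y n) (1 : Poly)
    rw [lie_Y_Y, smul_lie, smul_eq] at this
    rw [← lie_Y_eq hL hM hY, ← lie_Y_eq hL hM hY]
    exact this.symm
  LM m n := by
    have := lie_lie (L m) (M n) (1 : Poly)
    rw [lie_L_M, smul_lie, smul_eq] at this
    rw [← lie_L_eq hL hM hY, ← lie_M_eq hL hM hY]
    exact this.symm
  LY m n := by
    have := lie_lie (L m) (Y n) (1 : Poly)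
    rw [lie_L_Y, smul_lie, smul_eq] at this
    rw [← lie_L_eq hL hM hY, ← lie_Y_eq hL hM hY]
    exact this.symm
  LL m n := by
    have := lie_lie (L m) (L n) (1 : Poly)
    rw [lie_L_L, smul_lie, smul_eq] at this
    rw [← lie_L_eq hL hM hY, ← lie_L_eq hL hM hY]
    exact this.symm

namespace ActionRelations

variable {g u l : ℤ → Poly} (H : ActionRelations g u l)

include H

theorem g_ne_zero (m : ℤ) : g m ≠ 0 := by
  intro h
  rcases eq_or_ne m 0 with rfl | hm
  · exact t_ne_zero (H.g_zero.symm.trans h)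
  -- If g m = 0, the relation [L_{-m}, M_m] at 1 reads 0 = 2m t.
  · have := H.LM (-m) m
    rw [h, neg_add_cancel, H.g_zero] at this
    simp only [map_zero, mul_zero, zero_mul, sub_zero] at this
    refine mul_ne_zero (const_ne_zero ?_) t_ne_zero this.symm
    push_cast
    have : (m : ℂ) ≠ 0 := by exact_mod_cast hm
    intro h
    apply this
    linear_combination h / 2

/-- By `MM`, the product of g m and the shift by m of g (-m) is invariant under the shift by -m,
hence free of s, and so is its factor g m. -/
theorem Ds_g (m : ℤ) : Ds (g m) = 0 := by
  rcases eq_or_ne m 0 with rfl | hm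
  · rw [H.g_zero, Ds_t]
  · have hne := shiftHom_ne_zero m (H.g_ne_zero (-m))
    apply pderiv_left_eq_zero_of_mul (H.g_ne_zero m) hne
    apply Ds_eq_zero_of_shiftHom (m := -m) (by omega)
    rw [map_mul, shiftHom_shiftHom, neg_add_cancel, shiftHom_zero, ← H.MM, mul_comm]

theorem shiftHom_g (m n : ℤ) : shiftHom m (g n) = g n := shiftHom_of_Ds_eq_zero m (H.Ds_g n)

/-- Differentiating `YM` in s leaves only shift invariance of ∂u_m/∂s, since the g's do not involve
s. -/
theorem Ds_Ds_u (m : ℤ) : Ds (Ds (u m)) = 0 := by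
  apply Ds_eq_zero_of_shiftHom one_ne_zero
  have := congrArg Ds (H.YM m 1)
  simp only [map_add, MvPolynomial.pderiv_mul, H.shiftHom_g, H.Ds_g, pderiv_const,
    pderiv_comm 0 2, map_zero, pderiv_shiftHom] at this
  apply mul_right_cancel₀ (H.g_ne_zero 1)
  linear_combination -this

theorem Ds_u_mul (m n : ℤ) : const (n : ℂ) * Ds (u m) * g n = const (m : ℂ) * Dv (g n) * g m := by
  have := H.YM m n
  rw [H.shiftHom_g, shiftHom_of_Ds_Ds_eq_zero n (H.Ds_Ds_u m)] at this
  linear_combination -this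

/-- `Ds_u_mul` at n = m gives ∂u_m/∂s = ∂g_m/∂v. At n = -m it then says that g m * g (-m) has zero
derivative in v. -/
theorem Dv_g (m : ℤ) : Dv (g m) = 0 := by
  rcases eq_or_ne m 0 with rfl | hm
  · rw [H.g_zero, Dv_t]
  · have hm' : (m : ℂ) ≠ 0 := by exact_mod_cast hm
    apply pderiv_left_eq_zero_of_mul (H.g_ne_zero m) (H.g_ne_zero (-m))
    rw [MvPolynomial.pderiv_mul]
    have e1 := H.Ds_u_mul m m
    have e2 := H.Ds_u_mul m (-m)
    have e3 : Ds (u m) = Dv (g m) := by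
      apply mul_left_cancel₀ (const_ne_zero hm')
      apply mul_right_cancel₀ (H.g_ne_zero m)
      exact e1
    apply mul_left_cancel₀ (const_ne_zero hm')
    rw [e3, Int.cast_neg, const_neg] at e2
    linear_combination -e2

theorem Ds_u (m : ℤ) : Ds (u m) = 0 := by
  have := H.Ds_u_mul m 1
  rw [H.Dv_g, Int.cast_one, const_one, one_mul, mul_zero, zero_mul] at this
  exact (mul_eq_zero.1 this).resolve_right (H.g_ne_zero 1)

theorem shiftHom_u (m n : ℤ) : shiftHom m (u n) = u n := shiftHom_of_Ds_eq_zero m (H.Ds_u n)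

theorem Ds_Ds_l (m : ℤ) : Ds (Ds (l m)) = 0 := by
  apply Ds_eq_zero_of_shiftHom one_ne_zero
  have := congrArg Ds (H.LM m 1)
  simp only [map_sub, MvPolynomial.pderiv_mul, H.shiftHom_g, H.Ds_g, H.Dv_g, pderiv_const,
    pderiv_comm 0 1, map_zero, pderiv_shiftHom] at this
  apply mul_right_cancel₀ (H.g_ne_zero 1)
  linear_combination -this

theorem shiftHom_l (n m : ℤ) : shiftHom n (l m) = l m + const (n : ℂ) * Ds (l m) :=
  shiftHom_of_Ds_Ds_eq_zero n (H.Ds_Ds_l m)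

theorem Ds_l_mul (m n : ℤ) : const (n : ℂ) * Ds (l m) * g n =
    const (3 * (m : ℂ) + n) * g (m + n) - const (3 * (m : ℂ)) * g m * Dt (g n) := by
  have := H.LM m n
  rw [H.shiftHom_g, H.shiftHom_l, H.Dv_g, const_neg, map_zero] at this
  linear_combination -this

theorem Dv_Ds_l (m : ℤ) : Dv (Ds (l m)) = 0 := by
  have := congrArg Dv (H.Ds_l_mul m 1)
  simp only [map_sub, MvPolynomial.pderiv_mul, H.Dv_g, pderiv_const,
    pderiv_comm 2 1, map_zero, Int.cast_one, map_one, one_mul] at this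
  refine (mul_eq_zero.1 ?_).resolve_right (H.g_ne_zero 1)
  linear_combination this

theorem Ds_l_bracket (m n : ℤ) : const ((m : ℂ) - n) * (Ds (l m) * Ds (l n))
    - const (3 * (m : ℂ)) * g m * Dt (Ds (l n)) + const (3 * (n : ℂ)) * g n * Dt (Ds (l m))
    = const ((m : ℂ) - n) * Ds (l (m + n)) := by
  have := congrArg Ds (H.LL m n)
  simp only [map_sub, map_add, MvPolynomial.pderiv_mul, H.shiftHom_l, H.Ds_Ds_l, H.Ds_g, H.Ds_u,
    pderiv_const, pderiv_comm 0 1, pderiv_comm 0 2 (l _), pderiv_comm 0 2 (pderiv 2 (l _)),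
    map_zero, H.Dv_Ds_l] at this
  simp only [map_sub]
  linear_combination this

/-- Both g m and ∂l_m/∂s now lie in ℂ[t], and `Ds_l_mul`, `Ds_l_bracket` are the hypotheses of
`exists_exponential`. -/
theorem exists_scalar : ∃ lam : ℂ, lam ≠ 0 ∧ (∀ m, g m = const (lam ^ m) * t) ∧
    ∀ m, Ds (l m) = const (lam ^ m) := by
  choose p hp using fun m => exists_inT (H.Ds_g m) (H.Dv_g m)
  choose a ha using fun m => exists_inT (H.Ds_Ds_l m) (H.Dv_Ds_l m)
  have hp0 : p 0 = Polynomial.X := inT_injective (by rw [← hp, H.g_zero, inT_X])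
  have ha0 : a 0 = 1 := inT_injective (by rw [← ha, H.l_zero, Ds_s, inT_one])
  have hpne : ∀ m, p m ≠ 0 := fun m h => H.g_ne_zero m (by rw [hp, h, inT_zero])
  obtain ⟨lam, h0, h1, h2⟩ := exists_exponential hp0 ha0 hpne
    (fun m n => by
      apply inT_injective
      have := H.Ds_l_mul m n
      simp only [ha, hp, Dt_inT] at this
      simpa only [inT_mul, inT_C, inT_sub] using this)
    (fun m n => by
      apply inT_injective
      have := H.Ds_l_bracket m n
      simp only [ha, hp, Dt_inT] at this
      simpa only [inT_mul, inT_C, inT_sub, inT_add] using this)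
  refine ⟨lam, h0, fun m => ?_, fun m => ?_⟩
  · rw [hp, h1, inT_mul, inT_C, inT_X]
  · rw [ha, h2, inT_C]

end ActionRelations

/-! ### Solving for the action of Y_m -/

/-- The relations between the actions of `L_m` and `Y_m` on `1` after division by `λ ^ m`. -/
structure NormalizedRelations (y r : ℤ → Poly) : Prop where
  y_zero : y 0 = v
  r_zero : r 0 = 0
  Ds_y (m : ℤ) : Ds (y m) = 0
  Ds_r (m : ℤ) : Ds (r m) = 0
  YY (m n : ℤ) : const (m : ℂ) * Dv (y n) - const (n : ℂ) * Dv (y m) = const ((m : ℂ) - n)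
  LY (m n : ℤ) : const (3 * (m : ℂ)) * t * Dt (y n) + const (m : ℂ) * y m * Dv (y n)
      + const ((m : ℂ) ^ 2 / 2) * t * Dv (Dv (y n)) + const (n : ℂ) * y n
      + const (n : ℂ) * t * Dv (r m)
    = const ((m : ℂ) + n) * y (m + n)

theorem ActionRelations.exists_normalized {g u l : ℤ → Poly} (H : ActionRelations g u l) :
    ∃ (lam : ℂ) (y r : ℤ → Poly), lam ≠ 0 ∧ NormalizedRelations y r ∧
      ∀ m, g m = const (lam ^ m) * t ∧ u m = const (lam ^ m) * y m ∧
        l m = const (lam ^ m) * (s + r m) := by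
  obtain ⟨lam, h0, hg, hl⟩ := H.exists_scalar
  have hinv : ∀ m : ℤ, const (lam ^ m) * const (lam ^ (-m)) = 1 := by
    intro m
    rw [← const_mul, ← zpow_add₀ h0, add_neg_cancel, zpow_zero, const_one]
  have hadd : ∀ m n : ℤ, const (lam ^ (m + n)) = const (lam ^ m) * const (lam ^ n) := by
    intro m n
    rw [← const_mul, zpow_add₀ h0]
  have hne : ∀ m : ℤ, const (lam ^ m) ≠ 0 := fun m => const_ne_zero (zpow_ne_zero m h0)
  obtain ⟨y, hy⟩ : ∃ y : ℤ → Poly, ∀ m, u m = const (lam ^ m) * y m :=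
    ⟨fun m => const (lam ^ (-m)) * u m, fun m => by linear_combination -u m * hinv m⟩
  obtain ⟨r, hr⟩ : ∃ r : ℤ → Poly, ∀ m, l m = const (lam ^ m) * (s + r m) :=
    ⟨fun m => const (lam ^ (-m)) * l m - s, fun m => by linear_combination -l m * hinv m⟩
  refine ⟨lam, y, r, h0, ⟨?_, ?_, fun m => ?_, fun m => ?_, fun m n => ?_, fun m n => ?_⟩,
    fun m => ⟨hg m, hy m, hr m⟩⟩
  · have := hy 0
    rw [H.u_zero, zpow_zero, const_one] at this
    linear_combination -this
  · have := hr 0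
    rw [H.l_zero, zpow_zero, const_one] at this
    linear_combination -this
  · have := H.Ds_u m
    rw [hy, MvPolynomial.pderiv_C_mul] at this
    exact (mul_eq_zero.1 this).resolve_left (hne m)
  · have := hl m
    rw [hr, MvPolynomial.pderiv_C_mul, map_add, Ds_s] at this
    apply mul_left_cancel₀ (hne m)
    linear_combination this
  · have := H.YY m n
    rw [H.shiftHom_u, H.shiftHom_u, hg, hg, hg, hadd, hy, hy] at this
    simp only [MvPolynomial.pderiv_C_mul] at this
    apply mul_left_cancel₀ (mul_ne_zero (mul_ne_zero (hne m) (hne n)) t_ne_zero)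
    linear_combination this
  · have := H.LY m n
    rw [H.shiftHom_u, H.shiftHom_l, hl, hg, hg, hy, hy, hy, hadd, hr] at this
    simp only [map_add, pderiv_const, Dv_s, MvPolynomial.pderiv_mul,
      mul_zero, zero_mul, add_zero, zero_add, const_neg] at this
    apply mul_left_cancel₀ (mul_ne_zero (hne m) (hne n))
    rw [const_add]
    linear_combination -this

namespace NormalizedRelations

variable {y r : ℤ → Poly} (H : NormalizedRelations y r)

include H

theorem exists_y : ∃ (a b : ℂ) (W : Poly), Ds W = 0 ∧ ∀ n : ℤ,
    y n = const (n : ℂ) * W + v + const (a * (n : ℂ) ^ 2) * t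
      + const (if n = 0 then 0 else b) := by
  have hs : ∀ n : ℤ, Ds (y n - v - const (n : ℂ) * (y 1 - v)) = 0 := by
    intro n
    simp only [map_sub, MvPolynomial.pderiv_C_mul, H.Ds_y, Ds_v]
    ring
  -- `YY` at (1, n) makes ∂y_n/∂v affine in n, with value 1 at n = 0.
  have hv : ∀ n : ℤ, Dv (y n - v - const (n : ℂ) * (y 1 - v)) = 0 := by
    intro n
    have := H.YY 1 n
    rw [Int.cast_one, const_one, const_sub, const_one] at this
    simp only [map_sub, MvPolynomial.pderiv_C_mul, Dv_v]
    linear_combination this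
  choose h hh using fun n => exists_inT (hs n) (hv n)
  have hy : ∀ n, y n = v + const (n : ℂ) * (y 1 - v) + inT (h n) := fun n => by
    rw [← hh]; ring
  have h0 : h 0 = 0 := inT_injective (by
    rw [← hh, H.y_zero, Int.cast_zero, const_zero, inT_zero]; ring)
  have h1 : h 1 = 0 := inT_injective (by
    rw [← hh, Int.cast_one, const_one, inT_zero]; ring)
  -- The unknown ∂r_m/∂v and the terms in W enter `LY` linearly in n, so subtracting n times the
  -- relation at (m, 1) cancels them. The given `K` is the value forced at n = 1.
  obtain ⟨a, b, hab⟩ := cocycle_polynomial (h := h)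
      (K := fun m => Polynomial.C ((m : ℂ) + 1) * h (m + 1) - Polynomial.C (m : ℂ) * h m)
      h0 h1 (fun m n => by
    apply inT_injective
    simp only [inT_sub, inT_mul, inT_C, inT_X, ← Dt_inT]
    have e1 := H.LY m n
    have e2 := H.LY m 1
    have e3 : inT (h 1) = 0 := by rw [h1, inT_zero]
    obtain ⟨W, hW⟩ : ∃ W, y 1 = W + v := ⟨y 1 - v, by ring⟩
    rw [hy n, hy m, hy (m + n), hW] at e1
    rw [hy m, hy (m + 1), hW] at e2
    simp only [map_add, map_sub, MvPolynomial.pderiv_C_mul, Dv_v, Dt_v, Dv_inT, Int.cast_add,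
      Int.cast_one, map_zero, MvPolynomial.pderiv_one, const_one] at e1 e2 ⊢
    linear_combination const (n : ℂ) * e2 - e1)
  refine ⟨a, b, y 1 - v - const a * t - const b, ?_, fun n => ?_⟩
  · simp only [map_sub, MvPolynomial.pderiv_C_mul, H.Ds_y, Ds_v, Ds_t, pderiv_const]
    ring
  · rw [hy n, hab, inT_add, inT_mul, inT_C, inT_C, inT_X]
    split_ifs with hn
    · subst hn
      simp
    · simp only [const_mul, const_sub, const_one]
      ring

/-- `∂r_m/∂v` is expressed by `W`. -/
theorem t_mul_Dv_r {a b : ℂ} {W : Poly} (hy : ∀ n : ℤ, y n = const (n : ℂ) * W + v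
    + const (a * (n : ℂ) ^ 2) * t + const (if n = 0 then 0 else b)) (m : ℤ) :
    t * Dv (r m) = const (m : ℂ) * (2 * W - 3 * t * Dt W
      - (const (m : ℂ) * W + v + const (a * (m : ℂ) ^ 2) * t + const b) * Dv W
      - const ((m : ℂ) / 2) * t * Dv (Dv W) + const (3 * a * m) * t) := by
  rcases eq_or_ne m 0 with rfl | hm
  · simp [H.r_zero]
  have e := H.LY m 1
  -- The exceptional value of y (m + 1) at m = -1 is harmless: it is multiplied by m + 1.
  have hb : const ((m : ℂ) + (1 : ℤ)) * const (if m + 1 = 0 then 0 else b)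
      = const ((m : ℂ) + (1 : ℤ)) * const b := by
    split_ifs with h
    · have : (m : ℂ) + (1 : ℤ) = 0 := by exact_mod_cast h
      rw [this, const_zero]; ring
    · rfl
  rw [hy m, hy 1, hy (m + 1), if_neg hm, if_neg one_ne_zero, mul_add (const ((m : ℂ) + (1 : ℤ))),
    hb] at e
  have h2 : const ((m : ℂ) ^ 2 / 2) = const (m : ℂ) * const ((m : ℂ) / 2) := by
    rw [← const_mul]; congr 1; ring
  simp only [map_add, MvPolynomial.pderiv_mul, Dv_v, Dt_v, Dv_t, Dt_t, pderiv_const,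
    Int.cast_one, MvPolynomial.pderiv_one, Int.cast_add, const_one, const_mul, const_pow,
    const_ofNat, one_pow, one_mul, zero_mul, mul_zero, add_zero, mul_one, zero_add, h2] at e ⊢
  linear_combination e

end NormalizedRelations

/-! ### Divisibility by t and integration in v -/

/-- The substitution `t ↦ 0`. -/
def evalT : Poly →ₐ[ℂ] Poly := MvPolynomial.aeval ![s, 0, v]

theorem evalT_t : evalT t = 0 := by simp [evalT]

theorem evalT_v : evalT v = v := by simp [evalT]

theorem evalT_const (c : ℂ) : evalT (const c) = const c := by simp [evalT]

theorem t_dvd_sub_evalT (f : Poly) : t ∣ f - evalT f := by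
  induction f using MvPolynomial.induction_on with
  | C c => change t ∣ const c - evalT (const c); rw [evalT_const, sub_self]; exact dvd_zero _
  | add f g hf hg =>
    rw [map_add, add_sub_add_comm]
    exact dvd_add hf hg
  | mul_X f i hf =>
    rw [map_mul]
    fin_cases i
    · simpa [evalT, sub_mul] using hf.mul_right s
    · simp [evalT]
    · simpa [evalT, sub_mul] using hf.mul_right v

theorem Dv_evalT (f : Poly) : Dv (evalT f) = evalT (Dv f) := by
  induction f using MvPolynomial.induction_on with
  | C c =>
    change Dv (evalT (const c)) = evalT (Dv (const c))
    rw [evalT_const, pderiv_const, map_zero]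
  | add f g hf hg => simp only [map_add, hf, hg]
  | mul_X f j hf =>
    simp only [map_mul, MvPolynomial.pderiv_mul, map_add, hf]
    congr 2
    fin_cases j <;> simp [evalT, MvPolynomial.pderiv_X]

theorem NormalizedRelations.t_dvd_W {y r : ℤ → Poly} (H : NormalizedRelations y r) {a b : ℂ}
    {W : Poly} (hy : ∀ n : ℤ, y n = const (n : ℂ) * W + v
    + const (a * (n : ℂ) ^ 2) * t + const (if n = 0 then 0 else b)) : t ∣ W := by
  have e1 := congrArg evalT (H.t_mul_Dv_r hy 1)
  have e2 := congrArg evalT (H.t_mul_Dv_r hy 2)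
  simp only [map_add, map_sub, map_mul, evalT_t, evalT_v, evalT_const, zero_mul, mul_zero,
    ← Dv_evalT, Int.cast_one, Int.cast_ofNat, const_one, map_ofNat, one_mul] at e1 e2
  -- At t = 0 the identity is 2W = (mW + v + b) ∂W/∂v for m = 1 and m = 2; the difference is W ∂W/∂v
  -- = 0.
  have h1 : evalT W * Dv (evalT W) = 0 := by
    have : 2 * (evalT W * Dv (evalT W)) = 0 := by linear_combination e2 - 2 * e1
    exact (mul_eq_zero.1 this).resolve_left two_ne_zero
  have h2 : Dv (evalT W) = 0 := by
    rcases mul_eq_zero.1 h1 with h | h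
    · rw [h, map_zero]
    · exact h
  rw [h2] at e1
  have h3 : evalT W = 0 := by
    have : 2 * evalT W = 0 := by linear_combination -e1
    exact (mul_eq_zero.1 this).resolve_left two_ne_zero
  simpa [h3] using t_dvd_sub_evalT W

theorem t_dvd_inT {p : Polynomial ℂ} (h : Polynomial.X ∣ p) : t ∣ inT p := by
  obtain ⟨q, rfl⟩ := h
  rw [inT_mul, inT_X]
  exact dvd_mul_right _ _

theorem divT_t_mul (f : Poly) : divT (t * f) = f := MvPolynomial.X_mul_divMonomial 1 f

theorem exists_tauSum {W : Poly} (hs : Ds W = 0) (ht : t ∣ W) :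
    ∃ (q : ℕ) (τ : Fin (q + 1) → Polynomial ℂ), 1 ≤ q ∧ (∀ i, Polynomial.X ∣ τ i) ∧
      W = tauSum q τ := by
  obtain ⟨W', rfl⟩ := ht
  rw [MvPolynomial.pderiv_mul, Ds_t, zero_mul, zero_add] at hs
  obtain ⟨P, rfl⟩ := exists_ofTV ((mul_eq_zero.1 hs).resolve_left t_ne_zero)
  -- One more than the degree ensures q ≥ 1; the extra coefficient is zero.
  refine ⟨P.natDegree + 1, fun i => Polynomial.X * P.coeff i, by omega,
    fun i => dvd_mul_right _ _, ?_⟩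
  rw [tauSum, Fin.sum_univ_eq_sum_range (fun i => inT (Polynomial.X * P.coeff i) * v ^ i)]
  conv_lhs => rw [P.as_sum_range' (P.natDegree + 1 + 1) (by omega)]
  rw [map_sum, Finset.mul_sum]
  refine Finset.sum_congr rfl fun i _ => ?_
  rw [← Polynomial.C_mul_X_pow_eq_monomial, map_mul, map_pow, ofTV_X, ofTV_C, inT_mul, inT_X,
    mul_assoc]

section

variable {q : ℕ} {τ : Fin (q + 1) → Polynomial ℂ}

theorem Dv_tauSum : Dv (tauSum q τ) =
    ∑ i : Fin (q + 1), const ((i : ℕ) : ℂ) * inT (τ i) * v ^ ((i : ℕ) - 1) := by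
  rw [tauSum, map_sum]
  refine Finset.sum_congr rfl fun i _ => ?_
  rw [MvPolynomial.pderiv_mul, Dv_inT, MvPolynomial.pderiv_pow, Dv_v, const_natCast]
  ring

theorem v_mul_Dv_tauSum : v * Dv (tauSum q τ) =
    ∑ i : Fin (q + 1), const ((i : ℕ) : ℂ) * inT (τ i) * v ^ (i : ℕ) := by
  rw [Dv_tauSum, Finset.mul_sum]
  refine Finset.sum_congr rfl fun i _ => ?_
  rcases Nat.eq_zero_or_pos (i : ℕ) with h | h
  · simp [h]
  · conv_rhs => rw [← Nat.sub_add_cancel h, pow_succ, Nat.sub_add_cancel h]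
    ring

theorem Dt_tauSum : Dt (tauSum q τ) =
    ∑ i : Fin (q + 1), inT (Polynomial.derivative (τ i)) * v ^ (i : ℕ) := by
  rw [tauSum, map_sum]
  refine Finset.sum_congr rfl fun i _ => ?_
  rw [MvPolynomial.pderiv_mul, Dt_inT, MvPolynomial.pderiv_pow, Dt_v]
  ring

theorem Ds_tauSum : Ds (tauSum q τ) = 0 := by
  rw [tauSum, map_sum]
  refine Finset.sum_eq_zero fun i _ => ?_
  rw [MvPolynomial.pderiv_mul, Ds_inT, MvPolynomial.pderiv_pow, Ds_v]
  ring

theorem t_dvd_tauSum (hτ : ∀ i, Polynomial.X ∣ τ i) : t ∣ tauSum q τ :=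
  Finset.dvd_sum fun i _ => (t_dvd_inT (hτ i)).mul_right _

variable (a b : ℂ) (m : ℤ)

theorem phiNumerator_eq : phiNumerator a b q τ m =
    (∑ i : Fin (q + 1),
      (-inT (τ i) + const (3 / ((i : ℕ) + 1)) * inT (τ i)
        - const (3 / ((i : ℕ) + 1)) * t * inT (Polynomial.derivative (τ i))) * v ^ ((i : ℕ) + 1))
    - const ((m : ℂ) / 2) * t * Dv (tauSum q τ)
    - const ((m : ℂ) / 2) * tauSum q τ ^ 2
    + const (3 * a * m) * t * v
    - (const (a * (m : ℂ) ^ 2) * t + const b) * tauSum q τ := by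
  rw [phiNumerator, Dv_tauSum]

theorem t_dvd_phiNumerator (hτ : ∀ i, Polynomial.X ∣ τ i) : t ∣ phiNumerator a b q τ m := by
  have hW := t_dvd_tauSum hτ
  rw [phiNumerator_eq]
  refine dvd_sub (dvd_add (dvd_sub (dvd_sub (Finset.dvd_sum fun i _ => ?_) ?_) ?_) ?_) ?_
  · refine Dvd.dvd.mul_right (dvd_sub (dvd_add ?_ ?_) ?_) _
    · exact (t_dvd_inT (hτ i)).neg_right
    · exact (t_dvd_inT (hτ i)).mul_left _
    · exact (dvd_mul_left _ _).mul_right _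
  · exact (dvd_mul_left _ _).mul_right _
  · exact (dvd_pow hW two_ne_zero).mul_left _
  · exact (dvd_mul_left _ _).mul_right _
  · exact hW.mul_left _

theorem Ds_phiNumerator : Ds (phiNumerator a b q τ m) = 0 := by
  have hD : Ds (Dv (tauSum q τ)) = 0 := by rw [pderiv_comm, Ds_tauSum, map_zero]
  rw [phiNumerator_eq]
  simp only [map_sub, map_add, map_sum, map_neg, MvPolynomial.pderiv_mul, pderiv_const, Ds_t, Ds_v,
    Ds_inT, Ds_tauSum, hD, MvPolynomial.pderiv_pow, mul_zero, zero_mul, add_zero, sub_zero,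
    neg_zero, Finset.sum_const_zero]

/-- `phiNumerator` is designed as a v-primitive of the expression in
`NormalizedRelations.t_mul_Dv_r` (without the factor m). The factors 3/(i+1) come from integrating
v^i. -/
theorem Dv_phiNumerator : Dv (phiNumerator a b q τ m) =
    2 * tauSum q τ - 3 * t * Dt (tauSum q τ)
      - (const (m : ℂ) * tauSum q τ + v + const (a * (m : ℂ) ^ 2) * t + const b) *
        Dv (tauSum q τ)
      - const ((m : ℂ) / 2) * t * Dv (Dv (tauSum q τ)) + const (3 * a * m) * t := by
  have h1 : Dv (∑ i : Fin (q + 1),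
      (-inT (τ i) + const (3 / ((i : ℕ) + 1)) * inT (τ i)
        - const (3 / ((i : ℕ) + 1)) * t * inT (Polynomial.derivative (τ i))) * v ^ ((i : ℕ) + 1))
      = 2 * tauSum q τ - 3 * t * Dt (tauSum q τ) - v * Dv (tauSum q τ) := by
    rw [v_mul_Dv_tauSum, Dt_tauSum, tauSum, map_sum, Finset.mul_sum, Finset.mul_sum,
      ← Finset.sum_sub_distrib, ← Finset.sum_sub_distrib]
    refine Finset.sum_congr rfl fun i _ => ?_
    have h3 : const (3 / ((i : ℕ) + 1)) * (const ((i : ℕ) : ℂ) + 1) = 3 := by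
      rw [← const_one, ← const_add, ← const_mul, div_mul_cancel₀ _ (Nat.cast_add_one_ne_zero _),
        const_ofNat]
    simp only [MvPolynomial.pderiv_mul, map_sub, map_add, map_neg, Dv_inT, pderiv_const, Dv_t,
      MvPolynomial.pderiv_pow, Dv_v, Nat.add_sub_cancel]
    rw [const_natCast] at h3 ⊢
    push_cast
    linear_combination
      ((inT (τ i) - t * inT (Polynomial.derivative (τ i))) * v ^ (i : ℕ)) * h3
  have h2 : const ((m : ℂ) / 2) * 2 = const (m : ℂ) := by
    rw [← const_ofNat, ← const_mul, div_mul_cancel₀ _ two_ne_zero]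
  rw [phiNumerator_eq]
  simp only [map_sub, map_add, h1, MvPolynomial.pderiv_mul, pderiv_const, Dv_t, Dv_v,
    MvPolynomial.pderiv_pow]
  push_cast
  linear_combination (-tauSum q τ * Dv (tauSum q τ)) * h2

end

/-- Since m N_m / t and r_m have the same v-derivative and do not involve s, they differ by a
polynomial δ_m in t; γ_m is t δ_m. -/
theorem exists_isPhi [LieRingModule TSV Poly] [LieModule ℂ TSV Poly]
    (hL : ∀ f : Poly, ⁅L 0, f⁆ = s * f) (hM : ∀ f : Poly, ⁅M 0, f⁆ = t * f)
    (hY : ∀ f : Poly, ⁅Y 0, f⁆ = v * f) :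
    ∃ (lam a b : ℂ) (q : ℕ) (τ : Fin (q + 1) → Polynomial ℂ) (γ : ℤ → Polynomial ℂ),
      lam ≠ 0 ∧ 1 ≤ q ∧ (∀ i, Polynomial.X ∣ τ i) ∧ (∀ j, Polynomial.X ∣ γ j) ∧ γ 0 = 0 ∧
      IsPhi lam a b q τ γ := by
  obtain ⟨lam, y, r, h0, H, h1⟩ := (actionRelations hL hM hY).exists_normalized
  obtain ⟨a, b, W, hsW, hy⟩ := H.exists_y
  obtain ⟨q, τ, hq, hτ, rfl⟩ := exists_tauSum hsW (H.t_dvd_W hy)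
  choose N hN using fun m => t_dvd_phiNumerator a b m hτ
  have hsN : ∀ m, Ds (N m) = 0 := by
    intro m
    have := Ds_phiNumerator (τ := τ) a b m
    rw [hN, MvPolynomial.pderiv_mul, Ds_t, zero_mul, zero_add] at this
    exact (mul_eq_zero.1 this).resolve_left t_ne_zero
  have hδ : ∀ m, ∃ p, r m - const (m : ℂ) * N m = inT p := by
    intro m
    apply exists_inT
    · rw [map_sub, MvPolynomial.pderiv_C_mul, H.Ds_r, hsN, mul_zero, sub_zero]
    · have e1 := Dv_phiNumerator (τ := τ) a b m
      have e2 := H.t_mul_Dv_r hy m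
      rw [← e1, hN, MvPolynomial.pderiv_mul, Dv_t] at e2
      apply mul_left_cancel₀ t_ne_zero
      rw [map_sub, MvPolynomial.pderiv_C_mul]
      linear_combination e2
  choose δ hδ using hδ
  have hδ0 : δ 0 = 0 := inT_injective (by
    rw [← hδ, H.r_zero, Int.cast_zero, const_zero, inT_zero]; ring)
  refine ⟨lam, a, b, q, τ, fun m => Polynomial.X * δ m, h0, hq, hτ, fun m => dvd_mul_right _ _,
    by simp [hδ0], fun m f => ⟨?_, ?_, ?_⟩⟩
  -- `phiL` has b even at m = 0, where y 0 has 0; the factor m absorbs the difference.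
  · have hb : const (m : ℂ) * const (if m = 0 then 0 else b) = const (m : ℂ) * const b := by
      split_ifs with h
      · rw [h, Int.cast_zero, const_zero]; ring
      · rfl
    rw [lie_L_eq hL hM hY, (h1 m).1, (h1 m).2.1, (h1 m).2.2, hy, phiL, hN, divT_t_mul, inT_mul,
      inT_X, divT_t_mul, ← hδ]
    simp only [shift_eq, dt, dv]
    linear_combination (-const (lam ^ m) * Dv (shiftHom m f)) * hb
  · rw [lie_M_eq hL hM hY, (h1 m).1, phiM, shift_eq]
    ring
  · rw [lie_Y_eq hL hM hY, (h1 m).1, (h1 m).2.1, hy, phiY]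
    simp only [shift_eq, dv]
    ring

attribute [local instance 100] LieRing.ofAssociativeRing

/-! ### Modules that are free of rank one -/

theorem L_mem_zeroPart : L 0 ∈ zeroPart := Submodule.subset_span (by simp)

theorem M_mem_zeroPart : M 0 ∈ zeroPart := Submodule.subset_span (by simp)

theorem Y_mem_zeroPart : Y 0 ∈ zeroPart := Submodule.subset_span (by simp)

theorem lie_zeroPart (x y : zeroPart) : ⁅x, y⁆ = 0 := by
  obtain ⟨x, hx⟩ := x
  obtain ⟨y, hy⟩ := y
  apply Subtype.ext
  change ⁅x, y⁆ = 0
  have hx' : x ∈ Submodule.span ℂ {L 0, M 0, Y 0} := hx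
  have hy' : y ∈ Submodule.span ℂ {L 0, M 0, Y 0} := hy
  obtain ⟨a, b, c, rfl⟩ := Submodule.mem_span_triple.1 hx'
  obtain ⟨a', b', c', rfl⟩ := Submodule.mem_span_triple.1 hy'
  simp [lie_L_M, lie_L_Y, lie_Y_M, lie_M_L, lie_Y_L, lie_M_Y]

/-- The algebra `U(ℂ L_0 ⊕ ℂ M_0 ⊕ ℂ Y_0)` is commutative. -/
theorem UZero_mul_comm (x y : UZero) : x * y = y * x := by
  have hsurj : Function.Surjective (UniversalEnvelopingAlgebra.mkAlgHom ℂ zeroPart) :=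
    RingCon.mk'_surjective _
  have hadj : Algebra.adjoin ℂ (Set.range (UniversalEnvelopingAlgebra.ι ℂ (L := zeroPart))) = ⊤ := by
    have := congrArg (Subalgebra.map (UniversalEnvelopingAlgebra.mkAlgHom ℂ zeroPart))
      (TensorAlgebra.adjoin_range_ι (R := ℂ) (M := zeroPart))
    rw [AlgHom.map_adjoin, Algebra.map_top, (AlgHom.range_eq_top _).2 hsurj, ← Set.range_comp] at this
    exact this
  have hgen : ∀ a b : zeroPart, UniversalEnvelopingAlgebra.ι ℂ a * UniversalEnvelopingAlgebra.ι ℂ b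
      = UniversalEnvelopingAlgebra.ι ℂ b * UniversalEnvelopingAlgebra.ι ℂ a := by
    intro a b
    have := (UniversalEnvelopingAlgebra.ι ℂ (L := zeroPart)).map_lie a b
    rw [lie_zeroPart, map_zero, LieRing.of_associative_ring_bracket] at this
    exact (sub_eq_zero.1 this.symm)
  have hx : x ∈ Algebra.adjoin ℂ (Set.range (UniversalEnvelopingAlgebra.ι ℂ (L := zeroPart))) := by
    rw [hadj]; trivial
  have hy : y ∈ Algebra.adjoin ℂ (Set.range (UniversalEnvelopingAlgebra.ι ℂ (L := zeroPart))) := by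
    rw [hadj]; trivial
  -- An algebra generated by commuting elements lies in their double centralizer.
  refine Set.centralizer_centralizer_comm_of_comm ?_
    x (Algebra.adjoin_le_centralizer_centralizer ℂ _ hx)
    y (Algebra.adjoin_le_centralizer_centralizer ℂ _ hy)
  rintro _ ⟨a, rfl⟩ _ ⟨b, rfl⟩
  exact hgen a b

instance : CommRing UZero :=
  { (inferInstance : Ring UZero) with mul_comm := UZero_mul_comm }

/-- The homomorphism `ℂ[s, t, v] → U(ℂ L_0 ⊕ ℂ M_0 ⊕ ℂ Y_0)` with `s ↦ L_0`, `t ↦ M_0`,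
`v ↦ Y_0`. -/
def toUZero : Poly →ₐ[ℂ] UZero :=
  MvPolynomial.aeval ![UniversalEnvelopingAlgebra.ι ℂ (⟨L 0, L_mem_zeroPart⟩ : zeroPart),
    UniversalEnvelopingAlgebra.ι ℂ (⟨M 0, M_mem_zeroPart⟩ : zeroPart),
    UniversalEnvelopingAlgebra.ι ℂ (⟨Y 0, Y_mem_zeroPart⟩ : zeroPart)]

/-- The linear map with `L_m ↦ s`, `M_m ↦ t`, `Y_m ↦ v`. -/
def linearCoord : TSV →ₗ[ℂ] Poly :=
  basis.constr ℂ fun i => match i with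
    | .L _ => s
    | .M _ => t
    | .Y _ => v

theorem linearCoord_L (m : ℤ) : linearCoord (L m) = s := basis.constr_basis ℂ _ _

theorem linearCoord_M (m : ℤ) : linearCoord (M m) = t := basis.constr_basis ℂ _ _

theorem linearCoord_Y (m : ℤ) : linearCoord (Y m) = v := basis.constr_basis ℂ _ _

/-- The restriction of `linearCoord` to the abelian subalgebra `ℂ L_0 ⊕ ℂ M_0 ⊕ ℂ Y_0`. -/
def zeroPartCoord : zeroPart →ₗ⁅ℂ⁆ Poly :=
  { linearCoord.comp zeroPart.toSubmodule.subtype with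
    map_lie' := by
      intro x y
      rw [lie_zeroPart, LieRing.of_associative_ring_bracket, mul_comm, sub_self]
      exact map_zero (linearCoord.comp zeroPart.toSubmodule.subtype) }

theorem zeroPartCoord_apply (x : zeroPart) : zeroPartCoord x = linearCoord (x : TSV) := rfl

/-- The universal properties of the polynomial and enveloping algebras give mutually inverse
homomorphisms. Defining `linearCoord` on all of `TSV` avoids choosing a basis of `zeroPart`. -/
theorem toUZero_bijective : Function.Bijective toUZero := by
  have h1 : (UniversalEnvelopingAlgebra.lift ℂ zeroPartCoord).comp toUZero = AlgHom.id ℂ Poly := by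
    ext i : 1
    fin_cases i <;>
      simp only [toUZero, AlgHom.comp_apply, MvPolynomial.aeval_X] <;>
      refine (UniversalEnvelopingAlgebra.lift_ι_apply ℂ zeroPartCoord _).trans ?_
    · exact linearCoord_L 0
    · exact linearCoord_M 0
    · exact linearCoord_Y 0
  have h2 : toUZero.comp (UniversalEnvelopingAlgebra.lift ℂ zeroPartCoord)
      = AlgHom.id ℂ UZero := by
    apply UniversalEnvelopingAlgebra.hom_ext
    apply LieHom.ext
    rintro ⟨x, hx⟩
    change toUZero (UniversalEnvelopingAlgebra.lift ℂ zeroPartCoord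
      (UniversalEnvelopingAlgebra.ι ℂ ⟨x, hx⟩)) = UniversalEnvelopingAlgebra.ι ℂ ⟨x, hx⟩
    rw [UniversalEnvelopingAlgebra.lift_ι_apply, zeroPartCoord_apply]
    have hx' : x ∈ Submodule.span ℂ {L 0, M 0, Y 0} := hx
    obtain ⟨a, b, c, rfl⟩ := Submodule.mem_span_triple.1 hx'
    have : (⟨a • L 0 + b • M 0 + c • Y 0, hx⟩ : zeroPart) =
        a • (⟨L 0, L_mem_zeroPart⟩ : zeroPart) + b • (⟨M 0, M_mem_zeroPart⟩ : zeroPart)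
          + c • (⟨Y 0, Y_mem_zeroPart⟩ : zeroPart) := rfl
    have hc : linearCoord (a • L 0 + b • M 0 + c • Y 0) = a • s + b • t + c • v := by
      rw [map_add, map_add, map_smul, map_smul, map_smul, linearCoord_L, linearCoord_M,
        linearCoord_Y]
    refine (congrArg toUZero hc).trans ?_
    rw [this]
    simp only [map_add, map_smul, toUZero, MvPolynomial.aeval_X]
    rfl
  exact Function.bijective_iff_has_inverse.2 ⟨_, DFunLike.congr_fun h1, DFunLike.congr_fun h2⟩

section FreeModule

variable {B : Type*} [AddCommGroup B] [Module ℂ B] [LieRingModule TSV B] [LieModule ℂ TSV B]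

/-- A `tsv`-module that is free of rank one over `U(ℂ L_0 ⊕ ℂ M_0 ⊕ ℂ Y_0)` is identified with
`ℂ[s, t, v]`, where `L_0, M_0, Y_0` act by multiplication by `s, t, v`. -/
theorem IsFreeOfRankOne.exists_equiv (hB : IsFreeOfRankOne B) :
    ∃ e : Poly ≃ₗ[ℂ] B, ∀ f : Poly,
      e (s * f) = ⁅L 0, e f⁆ ∧ e (t * f) = ⁅M 0, e f⁆ ∧ e (v * f) = ⁅Y 0, e f⁆ := by
  let ρ := UniversalEnvelopingAlgebra.lift ℂ (LieModule.toEnd ℂ zeroPart B)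
  let _ : Module UZero B := Module.compHom B ρ.toRingHom
  obtain ⟨bas⟩ : Nonempty (Module.Basis (Fin 1) UZero B) := hB
  -- Acting on the single basis vector is the coordinate isomorphism of a free module of rank one.
  have hbij : Function.Bijective fun u : UZero => ρ u (bas 0) := by
    constructor
    · intro u u' h
      have h' : u • bas 0 = u' • bas 0 := h
      have := congrArg (fun x => bas.repr x 0) h'
      simpa using this
    · intro x
      refine ⟨bas.repr x 0, ?_⟩
      have := bas.sum_repr x
      rw [Fin.sum_univ_one] at this
      exact this
  let Ψ : Poly →ₗ[ℂ] B :=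
    (LinearMap.applyₗ (bas 0)).comp (ρ.comp toUZero).toLinearMap
  have hΨ : Function.Bijective Ψ := hbij.comp toUZero_bijective
  have hρ : ∀ (x : zeroPart) (b : B), ρ (UniversalEnvelopingAlgebra.ι ℂ x) b = ⁅(x : TSV), b⁆ := by
    intro x b
    exact DFunLike.congr_fun
      (UniversalEnvelopingAlgebra.lift_ι_apply ℂ (LieModule.toEnd ℂ zeroPart B) x) b
  have hmul : ∀ p f : Poly, Ψ (p * f) = ρ (toUZero p) (Ψ f) := by
    intro p f
    change ρ (toUZero (p * f)) (bas 0) = ρ (toUZero p) (ρ (toUZero f) (bas 0))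
    rw [map_mul, map_mul]
    rfl
  refine ⟨LinearEquiv.ofBijective Ψ hΨ, fun f => ⟨?_, ?_, ?_⟩⟩
  · refine (hmul _ _).trans ((congrArg (fun u => ρ u (Ψ f)) ?_).trans
      (hρ ⟨L 0, L_mem_zeroPart⟩ (Ψ f)))
    simp [toUZero]
  · refine (hmul _ _).trans ((congrArg (fun u => ρ u (Ψ f)) ?_).trans
      (hρ ⟨M 0, M_mem_zeroPart⟩ (Ψ f)))
    simp [toUZero]
  · refine (hmul _ _).trans ((congrArg (fun u => ρ u (Ψ f)) ?_).trans
      (hρ ⟨Y 0, Y_mem_zeroPart⟩ (Ψ f)))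
    simp [toUZero]

/-- The transport of a `tsv`-module structure along a linear equivalence. -/
@[reducible]
def transportLieRingModule (e : Poly ≃ₗ[ℂ] B) : LieRingModule TSV Poly where
  bracket x f := e.symm ⁅x, e f⁆
  add_lie x y f := by simp
  lie_add x f g := by simp
  leibniz_lie x y f := by simp

end FreeModule

end TSV

end

theorem theorem3p1 (B : Type*) [AddCommGroup B] [Module ℂ B] [LieRingModule TSV B]
    [LieModule ℂ TSV B] (hB : TSV.IsFreeOfRankOne B) :
    ∃ (lam a b : ℂ) (q : ℕ) (τ : Fin (q + 1) → Polynomial ℂ) (γ : ℤ → Polynomial ℂ),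
      lam ≠ 0 ∧ 1 ≤ q ∧
      (∀ i, Polynomial.X ∣ τ i) ∧ (∀ j, Polynomial.X ∣ γ j) ∧ γ 0 = 0 ∧
      ∃ (_ : LieRingModule TSV TSV.Poly) (_ : LieModule ℂ TSV TSV.Poly),
        TSV.IsPhi lam a b q τ γ ∧ Nonempty (B ≃ₗ⁅ℂ, TSV⁆ TSV.Poly) := by
  obtain ⟨e, he⟩ := hB.exists_equiv
  -- The structure on ℂ[s,t,v] is pulled back from `B`, so `e.symm` is equivariant by definition.
  let _ := TSV.transportLieRingModule e
  have hbr : ∀ (x : TSV) (f : TSV.Poly), ⁅x, f⁆ = e.symm ⁅x, e f⁆ := fun _ _ => rfl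
  have : LieModule ℂ TSV TSV.Poly :=
    { smul_lie := fun c x f => by simp [hbr]
      lie_smul := fun c x f => by simp [hbr] }
  obtain ⟨lam, a, b, q, τ, γ, h0, hq, hτ, hγ, hγ0, hΦ⟩ := TSV.exists_isPhi
    (fun f => by rw [hbr, ← (he f).1, e.symm_apply_apply])
    (fun f => by rw [hbr, ← (he f).2.1, e.symm_apply_apply])
    (fun f => by rw [hbr, ← (he f).2.2, e.symm_apply_apply])
  exact ⟨lam, a, b, q, τ, γ, h0, hq, hτ, hγ, hγ0, inferInstance, inferInstance, hΦ,
    ⟨{ e.symm with map_lie' := fun {x b} => by simp [hbr] }⟩⟩
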